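/- \textbf{Setting.} Let $k\in\{1,2\}$, with $k+1$ understood cyclically ($2+1=1$). Let $\eta_k\ge 1$ and $N\ge1$ be integers, $\nu_k>0$, $p_k>0$, $c_k\in\{-1,+1\}$, and let $f_k:\mathbb{R}\to\mathbb{R}$ be positive, bounded, Lipschitz continuous and non-decreasing. Put $\kappa=(\eta_1+1)+(\eta_2+1)$ and write $x\in\mathbb{R}^\kappa$ as $(x^{k,j})_{k=1,2;\,1\le j\le\eta_k+1}$. Let $A=\mathrm{diag}(A_{\nu_1},A_{\nu_2})$ be the block diagonal matrix in which $A_{\nu_k}\in\mathbb{R}^{(\eta_k+1)\times(\eta_k+1)}$ has all diagonal entries $-\nu_k$, all entries on the first upper diagonal $1$, and all other entries $0$. Let $B(x)\in\mathbb{R}^\kappa$ have coordinates $B(x)^{k,\eta_k+1}=c_kf_{k+1}(x^{k+1,1})$ and all other coordinates $0$. Let $\sigma(x)\in\mathbb{R}^{\kappa\times2}$ have, in row $(k,\eta_k+1)$ and column $k+1$, the entry $\frac{c_k}{\sqrt{p_{k+1}}}\sqrt{f_{k+1}(x^{k+1,1})}$, and all other entries $0$. For a step size $\Delta>0$ let $t_i=i\Delta$.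 The Lie--Trotter scheme started at $x_0\in\mathbb{R}^\kappa$ is the Markov chain $\tilde X_0=x_0$, $$\tilde X_{t_{i+1}}=e^{A\Delta}\Big(\tilde X_{t_i}+\Delta B(\tilde X_{t_i})+\frac{\sqrt\Delta}{\sqrt N}\,\sigma(\tilde X_{t_i})\,\xi_i\Big),\qquad i=0,1,2,\dots,$$ where $(\xi_i)_{i\ge 0}$ are i.i.d.\ two-dimensional standard normal vectors. Let $$\tilde G(x)=\sum_{k=1}^2\sum_{j=1}^{\eta_k+1}\frac{j}{\nu_k^{j-1}}\,|x^{k,j}|.$$ \textbf{Theorem (Geometric ergodicity).} For every $\Delta>0$ the Lie--Trotter scheme has a unique invariant probability measure $\pi^\Delta$ on $\mathbb{R}^\kappa$. Moreover, for every real $m\ge1$ there exist $\tilde C=\tilde C(m,\Delta)>0$ and $\tilde\lambda=\tilde\lambda(m,\Delta)>0$ (not depending on $x_0$, $g$ or $i$) such that for every $x_0\in\mathbb{R}^\kappa$ and every measurable $g:\mathbb{R}^\kappa\to\mathbb{R}$ with $|g|\le(1+\tilde G)^m$ (in particular for every measurable $g$ with $|g|\le\tilde G^m$), $g$ is $\pi^\Delta$-integrable,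 $g(\tilde X_{t_i})$ is integrable for every $i\ge0$, and $$\big|\mathbb{E}\,g(\tilde X_{t_i})-\pi^\Delta(g)\big|\le\tilde C\,(1+\tilde G(x_0))^m\,e^{-\tilde\lambda t_i}\qquad\text{for all } i=0,1,2,\dots$$ -/

import Mathlib

open MeasureTheory ProbabilityTheory

noncomputable section

/-- Parameters of the two-population cyclic feedback system with Erlang memory kernels.
Populations are indexed by `Fin 2`, so that `k + 1` is the population that acts on `k`. -/
structure HawkesModel where
  /-- memory orders -/
  η : Fin 2 → ℕ
  /-- decay rates of the memory kernels -/
  ν : Fin 2 → ℝ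
  /-- signs of the interactions: inhibitory `-1` or excitatory `1` -/
  c : Fin 2 → ℝ
  /-- limiting proportions of the populations -/
  p : Fin 2 → ℝ
  /-- total number of neurons -/
  N : ℕ
  /-- spiking rate functions -/
  f : Fin 2 → ℝ → ℝ
  one_le_η : ∀ k, 1 ≤ η k
  ν_pos : ∀ k, 0 < ν k
  c_sign : ∀ k, c k = 1 ∨ c k = -1
  p_pos : ∀ k, 0 < p k
  N_pos : 0 < N

namespace HawkesModel

/-- Assumption (A): the spiking rate functions are positive, bounded, Lipschitz continuous and
non-decreasing. -/
structure AssumptionA (M : HawkesModel) : Prop where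
  pos : ∀ k x, 0 < M.f k x
  bounded : ∀ k, ∃ fmax : ℝ, ∀ x, M.f k x ≤ fmax
  lipschitz : ∀ k, ∃ L : NNReal, LipschitzWith L (M.f k)
  mono : ∀ k, Monotone (M.f k)

/-- Coordinates `(k, j)`; the second component runs over `0, …, η k`, i.e. it is `j - 1` in the
usual numbering `j = 1, …, η k + 1`. -/
abbrev Idx (M : HawkesModel) : Type := (k : Fin 2) × Fin (M.η k + 1)

/-- The state space `ℝ ^ κ`, `κ = (η 0 + 1) + (η 1 + 1)`. -/
abbrev State (M : HawkesModel) : Type := M.Idx → ℝ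

/-- The diagonal block `A_{ν k}`: `-ν k` on the diagonal, `1` on the upper diagonal. -/
def blockA (M : HawkesModel) (k : Fin 2) :
    Matrix (Fin (M.η k + 1)) (Fin (M.η k + 1)) ℝ :=
  Matrix.of fun i j => if i = j then -M.ν k else if (i : ℕ) + 1 = (j : ℕ) then 1 else 0

/-- The block diagonal drift matrix `A`. -/
def A (M : HawkesModel) : Matrix M.Idx M.Idx ℝ := Matrix.blockDiagonal' M.blockA

/-- The non-linear part of the drift: `B(x)^{k, η k + 1} = c_k f_{k+1}(x^{k+1, 1})`, all other
coordinates vanish. -/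
def B (M : HawkesModel) (x : M.State) : M.State := fun i =>
  if i.2 = Fin.last (M.η i.1) then M.c i.1 * M.f (i.1 + 1) (x ⟨i.1 + 1, 0⟩) else 0

/-- The diffusion coefficient: the entry in row `(k, η k + 1)` and column `k + 1` is
`c_k / √p_{k+1} * √f_{k+1}(x^{k+1, 1})`, all other entries vanish. -/
def σ (M : HawkesModel) (x : M.State) : Matrix M.Idx (Fin 2) ℝ :=
  Matrix.of fun i l =>
    if i.2 = Fin.last (M.η i.1) ∧ l = i.1 + 1 then
      M.c i.1 / √(M.p (i.1 + 1)) * √(M.f (i.1 + 1) (x ⟨i.1 + 1, 0⟩))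
    else 0

/-- The flow `x ↦ e^{A t} x` of the linear subsystem. -/
def flow₁ (M : HawkesModel) (t : ℝ) (x : M.State) : M.State :=
  Matrix.mulVec (NormedSpace.exp (t • M.A)) x

/-- The stochastic flow of the non-linear subsystem, driven by the vector `ξ`. -/
def flow₂ (M : HawkesModel) (t : ℝ) (x : M.State) (ξ : Fin 2 → ℝ) : M.State :=
  x + t • M.B x + (√t / √(M.N : ℝ)) • Matrix.mulVec (M.σ x) ξ

/-- One step of the Lie–Trotter splitting scheme with step size `Δ`. -/
def step (M : HawkesModel) (Δ : ℝ) (x : M.State) (ξ : Fin 2 → ℝ) : M.State :=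
  M.flow₁ Δ (M.flow₂ Δ x ξ)

/-- The Lie–Trotter scheme started at `x₀` and driven by the vectors `ξ 0, ξ 1, …`;
`M.process Δ x₀ ξ i` is the value at time `t_i = i Δ`. -/
def process (M : HawkesModel) (Δ : ℝ) (x₀ : M.State) {Ω : Type*} (ξ : ℕ → Ω → Fin 2 → ℝ) :
    ℕ → Ω → M.State
  | 0, _ => x₀
  | i + 1, ω => M.step Δ (M.process Δ x₀ ξ i ω) (ξ i ω)

/-- The law of a two-dimensional standard normal vector. -/
def stdNormal : Measure (Fin 2 → ℝ) := Measure.pi fun _ => gaussianReal 0 1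

instance : IsProbabilityMeasure stdNormal := by
  unfold stdNormal; infer_instance

/-- The one-step transition kernel of the scheme: `x` is sent to the law of `M.step Δ x ξ` with
`ξ` standard normal (see `transition_apply`). -/
def transition (M : HawkesModel) (Δ : ℝ) : Kernel M.State M.State :=
  (Kernel.id ×ₖ Kernel.const M.State stdNormal).map fun q => M.step Δ q.1 q.2

/-- The Lyapunov function `∑ₖ ∑ⱼ j / ν_k ^ (j - 1) * |x^{k, j}|`. -/
def lyapunov (M : HawkesModel) (x : M.State) : ℝ :=
  ∑ k : Fin 2, ∑ j : Fin (M.η k + 1), ((j : ℝ) + 1) / M.ν k ^ (j : ℕ) * |x ⟨k, j⟩|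

theorem measurable_step (M : HawkesModel) (hA : M.AssumptionA) (Δ : ℝ) :
    Measurable fun q : M.State × (Fin 2 → ℝ) => M.step Δ q.1 q.2 := by
  have hf : ∀ k, Measurable (M.f k) := fun k => (hA.mono k).measurable
  have h2 : Measurable fun q : M.State × (Fin 2 → ℝ) => M.flow₂ Δ q.1 q.2 := by
    refine measurable_pi_lambda _ fun i => ?_
    have hc : Measurable fun q : M.State × (Fin 2 → ℝ) =>
        M.f (i.1 + 1) (q.1 ⟨i.1 + 1, 0⟩) := (hf _).comp (by fun_prop)
    simp only [flow₂, B, σ, Matrix.mulVec, dotProduct, Pi.add_apply, Pi.smul_apply,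
      Matrix.of_apply, smul_eq_mul]
    refine Measurable.add (Measurable.add (by fun_prop) ?_) ?_
    · split_ifs <;> fun_prop
    · refine Measurable.const_mul (Finset.measurable_sum _ fun l _ => ?_) _
      split_ifs <;> fun_prop
  refine measurable_pi_lambda _ fun i => ?_
  simp only [step, flow₁, Matrix.mulVec, dotProduct]
  refine Finset.measurable_sum _ fun j _ => Measurable.const_mul ?_ _
  exact (measurable_pi_apply j).comp h2

theorem transition_apply (M : HawkesModel) (hA : M.AssumptionA) (Δ : ℝ) (x : M.State) :
    M.transition Δ x = stdNormal.map (M.step Δ x) := by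
  have hm := M.measurable_step hA Δ
  rw [transition, Kernel.map_apply _ hm, Kernel.prod_apply, Kernel.id_apply, Kernel.const_apply,
    Measure.dirac_prod, Measure.map_map hm (by fun_prop)]
  rfl

end HawkesModel

end

/-! The proof is Harris' theorem in the Hairer–Mattingly form: a drift condition together with a
minorization on sublevel sets makes a power of the transition kernel a contraction for a weighted
oscillation seminorm (`DriftCondition.exists_contraction`, `DriftCondition.exists_geometric`).
Consecutive laws of the chain are then Cauchy uniformly over measurable sets. Their limit is an
invariant probability measure, and no continuity of the kernel is needed.

Drift: in the weighted ℓ¹ norm `lyapunov` the flow e^{AΔ} is a strict contraction, because the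
numerators j grow along each Erlang chain (`sum_weight_upper_le`). Since f is bounded, the kick
added before the flow is dominated by a variable whose law does not depend on the state. Convexity
of t ↦ t^m carries the drift over to (1+G)^m (`exists_driftCondition`).

Minorization: noise enters only in the last coordinate of each block, so a single step is
degenerate. The linear flow spreads it along the chain, and after finitely many steps every state is
reachable by linear controls (`exists_steer_rightInverse`). On bounded sets the Gaussian kick
dominates a multiple of a uniform law on any translated unit square with bounded offset. Choosing
the translations as a control that steers x to 0 gives the same minorizing measure for every x in a
sublevel set (`exists_minorization`); no density of the n-step law is computed. -/

noncomputable section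

open Filter Topology

/-! ### Drift conditions and the weighted contraction estimate. -/

namespace ProbabilityTheory.Kernel

variable {S : Type*} [MeasurableSpace S]

/-- The Foster–Lyapunov drift condition `κ V ≤ γ V + K` for a function `V ≥ 1`. -/
structure DriftCondition (κ : Kernel S S) (V : S → ℝ) (γ K : ℝ) : Prop where
  measurable : Measurable V
  one_le : ∀ x, 1 ≤ V x
  γ_nonneg : 0 ≤ γ
  γ_lt_one : γ < 1
  K_nonneg : 0 ≤ K
  integrable : ∀ x, Integrable V (κ x)
  integral_le : ∀ x, ∫ y, V y ∂κ x ≤ γ * V x + K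

instance isMarkovKernel_pow (κ : Kernel S S) [IsMarkovKernel κ] (n : ℕ) :
    IsMarkovKernel (κ ^ n) := by
  induction n with
  | zero => rw [pow_zero]; exact inferInstanceAs (IsMarkovKernel Kernel.id)
  | succ n ih => rw [pow_succ]; exact inferInstanceAs (IsMarkovKernel ((κ ^ n) ∘ₖ κ))

theorem pow_zero_apply (κ : Kernel S S) (x : S) : (κ ^ 0) x = Measure.dirac x := by
  rw [pow_zero]; exact Kernel.id_apply x

theorem pow_succ_apply (κ : Kernel S S) (n : ℕ) (x : S) :
    (κ ^ (n + 1)) x = (κ ^ n) ∘ₘ (κ x) := by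
  rw [pow_succ]; exact Kernel.comp_apply _ _ _

theorem pow_succ_apply' (κ : Kernel S S) (n : ℕ) (x : S) :
    (κ ^ (n + 1)) x = κ ∘ₘ ((κ ^ n) x) := by
  rw [pow_succ']; exact Kernel.comp_apply _ _ _

theorem integral_measure_comp {κ : Kernel S S} {μ : Measure S} {f : S → ℝ}
    (hf : Integrable f (κ ∘ₘ μ)) : ∫ z, f z ∂(κ ∘ₘ μ) = ∫ x, ∫ y, f y ∂κ x ∂μ := by
  rw [Measure.comp_eq_comp_const_apply] at hf ⊢
  rw [Kernel.integral_comp hf, Kernel.const_apply]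

theorem measurable_integral (κ : Kernel S S) [IsSFiniteKernel κ] {f : S → ℝ}
    (hf : Measurable f) : Measurable fun x => ∫ y, f y ∂κ x :=
  hf.stronglyMeasurable.integral_kernel.measurable

theorem Invariant.pow {κ : Kernel S S} {μ : Measure S} (h : Invariant κ μ) (n : ℕ) :
    Invariant (κ ^ n) μ := by
  induction n with
  | zero => rw [pow_zero]; exact Measure.id_comp
  | succ n ih => rw [pow_succ]; exact ih.comp h

namespace DriftCondition

variable {κ : Kernel S S} {V : S → ℝ} {γ K : ℝ}

theorem pos (h : DriftCondition κ V γ K) (x : S) : 0 < V x := zero_lt_one.trans_le (h.one_le x)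

variable [IsMarkovKernel κ]

theorem integrable_comp (h : DriftCondition κ V γ K) {μ : Measure S} [IsProbabilityMeasure μ]
    (hμ : Integrable V μ) : Integrable V (κ ∘ₘ μ) := by
  rw [Measure.integrable_comp_iff h.measurable.aestronglyMeasurable]
  refine ⟨ae_of_all _ h.integrable, ?_⟩
  refine Integrable.mono' ((hμ.const_mul γ).add (integrable_const K))
    (measurable_integral κ h.measurable.norm).aestronglyMeasurable (ae_of_all _ fun x => ?_)
  simp only [Real.norm_eq_abs, abs_of_pos (h.pos _)]
  rw [abs_of_nonneg (integral_nonneg fun y => (h.pos y).le)]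
  exact h.integral_le x

theorem integral_comp_le (h : DriftCondition κ V γ K) {μ : Measure S} [IsProbabilityMeasure μ]
    (hμ : Integrable V μ) : ∫ x, V x ∂(κ ∘ₘ μ) ≤ γ * ∫ x, V x ∂μ + K := by
  have hi := h.integrable_comp hμ
  rw [integral_measure_comp hi]
  have h2 : ∫ x, (γ * V x + K) ∂μ = γ * ∫ x, V x ∂μ + K := by
    rw [integral_add (hμ.const_mul γ) (integrable_const K), integral_const_mul]; simp
  rw [← h2]
  refine integral_mono_of_nonneg (ae_of_all _ fun x => integral_nonneg fun y => (h.pos y).le)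
    ((hμ.const_mul γ).add (integrable_const K)) (ae_of_all _ h.integral_le)

theorem pow_bound (h : DriftCondition κ V γ K) (n : ℕ) (x : S) :
    Integrable V ((κ ^ n) x) ∧ ∫ y, V y ∂(κ ^ n) x ≤ γ ^ n * V x + K / (1 - γ) := by
  have h1 : 0 < 1 - γ := sub_pos.2 h.γ_lt_one
  induction n with
  | zero =>
    rw [pow_zero_apply]
    refine ⟨integrable_dirac' h.measurable.stronglyMeasurable (by simp), ?_⟩
    rw [integral_dirac' _ _ h.measurable.stronglyMeasurable]
    have := div_nonneg h.K_nonneg h1.le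
    simpa using this
  | succ n ih =>
    rw [pow_succ_apply']
    refine ⟨h.integrable_comp ih.1, (h.integral_comp_le ih.1).trans ?_⟩
    have h3 := mul_le_mul_of_nonneg_left ih.2 h.γ_nonneg
    have h4 : γ * (K / (1 - γ)) + K = K / (1 - γ) := by field_simp; ring
    calc _ ≤ γ * (γ ^ n * V x + K / (1 - γ)) + K := by gcongr
      _ = γ ^ (n + 1) * V x + (γ * (K / (1 - γ)) + K) := by ring
      _ = _ := by rw [h4]

theorem pow (h : DriftCondition κ V γ K) {n : ℕ} (hn : n ≠ 0) :
    DriftCondition (κ ^ n) V γ (K / (1 - γ)) where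
  measurable := h.measurable
  one_le := h.one_le
  γ_nonneg := h.γ_nonneg
  γ_lt_one := h.γ_lt_one
  K_nonneg := div_nonneg h.K_nonneg (sub_pos.2 h.γ_lt_one).le
  integrable x := (h.pow_bound n x).1
  integral_le x := by
    refine (h.pow_bound n x).2.trans ?_
    have := pow_le_of_le_one h.γ_nonneg h.γ_lt_one.le hn
    have := h.pos x
    gcongr

end DriftCondition

/-- A function whose weighted oscillation is at most `D` lies within `D (1 + β V)` of a
constant. -/
theorem exists_center {T : Type*} [Nonempty T] {V φ : T → ℝ} {β D : ℝ}
    (h : ∀ x y, |φ x - φ y| ≤ D * (2 + β * (V x + V y))) :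
    ∃ c, ∀ x, |φ x - c| ≤ D * (1 + β * V x) := by
  have key : ∀ x y, φ x - D * (1 + β * V x) ≤ φ y + D * (1 + β * V y) := fun x y => by
    have := (abs_le.1 (h x y)).2
    linarith
  have hb : BddAbove (Set.range fun x => φ x - D * (1 + β * V x)) := by
    obtain ⟨y⟩ := ‹Nonempty T›
    exact ⟨_, by rintro _ ⟨x, rfl⟩; exact key x y⟩
  -- By `key` every lower barrier lies below every upper barrier, so the supremum of the lower ones
  -- separates the two families.
  refine ⟨⨆ x, (φ x - D * (1 + β * V x)), fun x => abs_le.2 ⟨?_, ?_⟩⟩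
  · have := ciSup_le fun y => key y x
    linarith
  · have := le_ciSup hb x
    linarith

/-- Since W - ψ ≥ 0, its μ-integral is at least α times its ν-integral, and ∫ W dν ≥ D. Applied to
two measures dominating the same αν, the ν-terms cancel in the difference and each side gains αD. -/
theorem integral_sub_le_of_minorization {μ ν : Measure S} [IsProbabilityMeasure μ]
    [IsProbabilityMeasure ν] {α : ℝ} (hα : 0 ≤ α) (hle : ENNReal.ofReal α • ν ≤ μ)
    {ψ W : S → ℝ} (hψ : Measurable ψ) (hψW : ∀ x, |ψ x| ≤ W x) (hW1 : Integrable W μ) (D : ℝ)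
    (hDW : ∀ x, D ≤ W x) :
    ∫ x, ψ x ∂μ - α * ∫ x, ψ x ∂ν ≤ ∫ x, W x ∂μ - α * D := by
  have hψμ : Integrable ψ μ := hW1.mono' hψ.aestronglyMeasurable (ae_of_all _ hψW)
  have hs : Integrable (fun x => W x - ψ x) μ := hW1.sub hψμ
  have h1 := integral_mono_measure hle
    (ae_of_all _ fun x => sub_nonneg.2 ((le_abs_self _).trans (hψW x))) hs
  rw [integral_smul_measure, ENNReal.toReal_ofReal hα, integral_sub hW1 hψμ, smul_eq_mul] at h1
  rcases hα.eq_or_lt with rfl | hα'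
  · simp only [zero_mul] at h1 ⊢; linarith
  have hWν : Integrable W ν := by
    have := hW1.mono_measure hle
    rwa [integrable_smul_measure (by simpa using hα') ENNReal.ofReal_ne_top] at this
  have hψν : Integrable ψ ν := hWν.mono' hψ.aestronglyMeasurable (ae_of_all _ hψW)
  rw [integral_sub hWν hψν] at h1
  have h2 : D ≤ ∫ x, W x ∂ν := by
    simpa using integral_mono (integrable_const D) hWν hDW
  nlinarith [mul_le_mul_of_nonneg_left h2 hα]

/-- For large s the drift alone contracts, with γ relaxed to the midpoint (1+γ)/2. For the remaining
s the gain 2α from minorization must pay for 2βK, so β is chosen with 2βK ≤ α. The summand 1 in the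
threshold keeps it positive, which makes ρ₁ strictly less than 1. -/
theorem contraction_constants {γ K : ℝ} (hγ0 : 0 ≤ γ) (hγ1 : γ < 1) (hK : 0 ≤ K) {α : ℝ}
    (hα : 0 < α) :
    ∃ β ρ : ℝ, 0 < β ∧ 0 < ρ ∧ ρ < 1 ∧
      (∀ s, 4 * K / (1 - γ) + 1 ≤ s → 2 + β * (γ * s + 2 * K) ≤ ρ * (2 + β * s)) ∧
      (∀ s, 0 ≤ s → 2 * (1 - α) + β * (γ * s + 2 * K) ≤ ρ * (2 + β * s)) := by
  have h1 : 0 < 1 - γ := sub_pos.2 hγ1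
  set R := 4 * K / (1 - γ) + 1 with hR
  have hR0 : 0 < R := by positivity
  have hRK : 4 * K + (1 - γ) = R * (1 - γ) := by rw [hR]; field_simp
  set β := α / (2 * (K + 1)) with hβ
  have hβ0 : 0 < β := by positivity
  have hβK : β * (2 * K) ≤ α := by
    rw [hβ, div_mul_eq_mul_div, div_le_iff₀ (by positivity)]; nlinarith
  set γ' := (1 + γ) / 2 with hγ'
  set ρ₁ := (2 + β * γ' * R) / (2 + β * R) with hρ₁
  have hd : 0 < 2 + β * R := by positivity
  have hρ₁1 : ρ₁ < 1 := by
    rw [hρ₁, div_lt_one hd]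
    have : 0 < β * R := by positivity
    nlinarith
  have hρ₁0 : 0 < ρ₁ := by positivity
  have hγρ : γ' ≤ ρ₁ := by
    rw [hρ₁, le_div_iff₀ hd]; nlinarith
  have hρ₁e : ρ₁ * (2 + β * R) = 2 + β * γ' * R := by rw [hρ₁]; field_simp
  set ρ := max ρ₁ (max (1 - α / 2) γ) with hρ
  have a1 : ρ₁ ≤ ρ := le_max_left _ _
  have a2 : 1 - α / 2 ≤ ρ := (le_max_left _ _).trans (le_max_right _ _)
  have a3 : γ ≤ ρ := (le_max_right _ _).trans (le_max_right _ _)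
  refine ⟨β, ρ, hβ0, hρ₁0.trans_le a1, ?_, fun s hs => ?_, fun s hs => ?_⟩
  · simp only [hρ, max_lt_iff]; exact ⟨hρ₁1, by linarith, hγ1⟩
  · have b1 : γ * s + 2 * K ≤ γ' * s := by
      have := mul_le_mul_of_nonneg_right hs h1.le
      rw [hγ']; nlinarith
    have b2 : ρ₁ * (2 + β * s) ≤ ρ * (2 + β * s) := by
      have : 0 ≤ s := hR0.le.trans hs
      gcongr
    have b3 : β * (γ * s + 2 * K) ≤ β * (γ' * s) := by gcongr
    have b4 : γ' * (β * (s - R)) ≤ ρ₁ * (β * (s - R)) :=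
      mul_le_mul_of_nonneg_right hγρ (mul_nonneg hβ0.le (sub_nonneg.2 hs))
    nlinarith
  · have b1 : γ * (β * s) ≤ ρ * (β * s) := by gcongr
    nlinarith

/-- The Hairer–Mattingly contraction estimate: drift and minorization on sublevel sets make the
kernel a contraction for a weighted oscillation seminorm. -/
theorem DriftCondition.exists_contraction [Nonempty S] {κ : Kernel S S} [IsMarkovKernel κ]
    {V : S → ℝ} {γ K : ℝ} (h : DriftCondition κ V γ K) {ν : Measure S} [IsProbabilityMeasure ν]
    (hν : ∀ R : ℝ, ∃ α : ℝ, 0 < α ∧ ∀ x, V x ≤ R → ENNReal.ofReal α • ν ≤ κ x) :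
    ∃ β ρ : ℝ, 0 < β ∧ 0 < ρ ∧ ρ < 1 ∧ ∀ (φ : S → ℝ) (D : ℝ), Measurable φ → 0 ≤ D →
      (∀ x y, |φ x - φ y| ≤ D * (2 + β * (V x + V y))) →
      ∀ x y, |∫ z, φ z ∂κ x - ∫ z, φ z ∂κ y| ≤ ρ * D * (2 + β * (V x + V y)) := by
  obtain ⟨α₀, hα₀, hmin₀⟩ := hν (4 * K / (1 - γ) + 1)
  set α := min α₀ 1
  have hα : 0 < α := lt_min hα₀ one_pos
  have hmin : ∀ x, V x ≤ 4 * K / (1 - γ) + 1 → ENNReal.ofReal α • ν ≤ κ x := fun x hx =>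
    le_trans (by gcongr; exact min_le_left _ _) (hmin₀ x hx)
  obtain ⟨β, ρ, hβ, hρ0, hρ1, hfar, hnear⟩ :=
    contraction_constants h.γ_nonneg h.γ_lt_one h.K_nonneg hα
  refine ⟨β, ρ, hβ, hρ0, hρ1, fun φ D hφ hD hosc x y => ?_⟩
  obtain ⟨c, hc⟩ := exists_center hosc
  have hWi : ∀ x, Integrable (fun z => D * (1 + β * V z)) (κ x) := fun x =>
    ((integrable_const 1).add ((h.integrable x).const_mul β)).const_mul D
  have hψi : ∀ x, Integrable (fun z => φ z - c) (κ x) := fun x =>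
    (hWi x).mono' (hφ.sub_const c).aestronglyMeasurable (ae_of_all _ hc)
  have hφi : ∀ x, Integrable φ (κ x) := fun x => by
    exact ((hψi x).add (integrable_const c)).congr (ae_of_all _ fun z => by simp)
  have hφψ : ∀ x, ∫ z, φ z ∂κ x = ∫ z, (φ z - c) ∂κ x + c := fun x => by
    rw [integral_sub (hφi x) (integrable_const c)]; simp
  have hWe : ∀ x, ∫ z, D * (1 + β * V z) ∂κ x ≤ D * (1 + β * (γ * V x + K)) := fun x => by
    have e : ∫ z, D * (1 + β * V z) ∂κ x = D * (1 + β * ∫ z, V z ∂κ x) := by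
      rw [integral_const_mul, integral_add (integrable_const 1) ((h.integrable x).const_mul β),
        integral_const_mul]; simp
    rw [e]
    have := h.integral_le x
    gcongr
  rw [hφψ x, hφψ y, add_sub_add_right_eq_sub]
  have hVx := h.pos x
  have hVy := h.pos y
  -- If V x + V y is large, the drift bound on each integral suffices. Otherwise both points lie in
  -- the sublevel set, and the common part αν is subtracted from both laws.
  by_cases hs : 4 * K / (1 - γ) + 1 ≤ V x + V y
  · have b : ∀ x, |∫ z, (φ z - c) ∂κ x| ≤ D * (1 + β * (γ * V x + K)) := fun x =>
      le_trans (norm_integral_le_of_norm_le (f := fun z => φ z - c) (hWi x) (ae_of_all _ hc))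
        (hWe x)
    calc |∫ z, (φ z - c) ∂κ x - ∫ z, (φ z - c) ∂κ y|
        ≤ |∫ z, (φ z - c) ∂κ x| + |∫ z, (φ z - c) ∂κ y| := abs_sub _ _
      _ ≤ D * (1 + β * (γ * V x + K)) + D * (1 + β * (γ * V y + K)) := add_le_add (b x) (b y)
      _ = D * (2 + β * (γ * (V x + V y) + 2 * K)) := by ring
      _ ≤ D * (ρ * (2 + β * (V x + V y))) := mul_le_mul_of_nonneg_left (hfar _ hs) hD
      _ = _ := by ring
  · have hle : ∀ x, D ≤ D * (1 + β * V x) := fun x => by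
      have := h.pos x
      nlinarith [mul_nonneg hD (mul_nonneg hβ.le this.le)]
    have hneg : ∀ x, ∫ z, -(φ z - c) ∂κ x = - ∫ z, (φ z - c) ∂κ x := fun x => integral_neg _
    have hnegν : ∫ z, -(φ z - c) ∂ν = - ∫ z, (φ z - c) ∂ν := integral_neg _
    have up : ∀ x, V x ≤ 4 * K / (1 - γ) + 1 →
        ∫ z, (φ z - c) ∂κ x - α * ∫ z, (φ z - c) ∂ν ≤
          D * (1 + β * (γ * V x + K)) - α * D := fun x hx =>
      (integral_sub_le_of_minorization hα.le (hmin x hx) (hφ.sub_const c) hc (hWi x) D hle).trans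
        (sub_le_sub_right (hWe x) _)
    have lo : ∀ x, V x ≤ 4 * K / (1 - γ) + 1 →
        - (∫ z, (φ z - c) ∂κ x - α * ∫ z, (φ z - c) ∂ν) ≤
          D * (1 + β * (γ * V x + K)) - α * D := fun x hx => by
      have := (integral_sub_le_of_minorization hα.le (hmin x hx) (hφ.sub_const c).neg
        (fun z => by rw [Pi.neg_apply, abs_neg]; exact hc z) (hWi x) D hle).trans
        (sub_le_sub_right (hWe x) _)
      simp only [Pi.neg_apply] at this
      rw [hneg, hnegν] at this
      linarith
    have hx : V x ≤ 4 * K / (1 - γ) + 1 := by linarith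
    have hy : V y ≤ 4 * K / (1 - γ) + 1 := by linarith
    have hn := mul_le_mul_of_nonneg_left (hnear (V x + V y) (by linarith)) hD
    have := up x hx
    have := up y hy
    have := lo x hx
    have := lo y hy
    rw [abs_le]
    constructor <;> nlinarith

/-- Contraction along the powers of a kernel. -/
theorem integral_pow_contraction {κ : Kernel S S} [IsMarkovKernel κ] {V : S → ℝ} {β ρ : ℝ}
    (hρ : 0 ≤ ρ)
    (h : ∀ (φ : S → ℝ) (D : ℝ), Measurable φ → 0 ≤ D →
      (∀ x y, |φ x - φ y| ≤ D * (2 + β * (V x + V y))) →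
      ∀ x y, |∫ z, φ z ∂κ x - ∫ z, φ z ∂κ y| ≤ ρ * D * (2 + β * (V x + V y)))
    (n : ℕ) {φ : S → ℝ} {D : ℝ} (hφ : Measurable φ) (hD : 0 ≤ D)
    (hosc : ∀ x y, |φ x - φ y| ≤ D * (2 + β * (V x + V y)))
    (hint : ∀ n x, Integrable φ ((κ ^ n) x)) (x y : S) :
    |∫ z, φ z ∂(κ ^ n) x - ∫ z, φ z ∂(κ ^ n) y| ≤ ρ ^ n * D * (2 + β * (V x + V y)) := by
  induction n generalizing x y with
  | zero =>
    simp only [pow_zero_apply]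
    rw [integral_dirac' _ _ hφ.stronglyMeasurable, integral_dirac' _ _ hφ.stronglyMeasurable]
    simpa using hosc x y
  | succ n ih =>
    have e : ∀ x, ∫ z, φ z ∂(κ ^ (n + 1)) x = ∫ y, ∫ z, φ z ∂(κ ^ n) y ∂κ x := fun x => by
      rw [pow_succ_apply, integral_measure_comp]
      rw [← pow_succ_apply]; exact hint _ _
    rw [e, e]
    have := h (fun y => ∫ z, φ z ∂(κ ^ n) y) (ρ ^ n * D) (measurable_integral _ hφ)
      (by positivity) ih x y
    calc _ ≤ _ := this
      _ = _ := by ring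

theorem DriftCondition.integrable_of_abs_le {κ : Kernel S S} [IsMarkovKernel κ]
    {V : S → ℝ} {γ K : ℝ} (h : DriftCondition κ V γ K) {φ : S → ℝ} (hφ : Measurable φ)
    (hφV : ∀ x, |φ x| ≤ V x) (n : ℕ) (x : S) : Integrable φ ((κ ^ n) x) :=
  (h.pow_bound n x).1.mono' hφ.aestronglyMeasurable (ae_of_all _ hφV)

/-- Weighted geometric ergodicity of the powers of a kernel satisfying a drift condition and a
minorization condition for some power. -/
theorem DriftCondition.exists_geometric [Nonempty S] {κ : Kernel S S} [IsMarkovKernel κ]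
    {V : S → ℝ} {γ K : ℝ} (h : DriftCondition κ V γ K) {n : ℕ} (hn : n ≠ 0) {ν : Measure S}
    [IsProbabilityMeasure ν]
    (hν : ∀ R : ℝ, ∃ α : ℝ, 0 < α ∧ ∀ x, V x ≤ R → ENNReal.ofReal α • ν ≤ (κ ^ n) x) :
    ∃ C ρ : ℝ, 0 < C ∧ 0 < ρ ∧ ρ < 1 ∧ ∀ φ : S → ℝ, Measurable φ → (∀ x, |φ x| ≤ V x) →
      ∀ j x y, |∫ z, φ z ∂(κ ^ j) x - ∫ z, φ z ∂(κ ^ j) y| ≤ C * ρ ^ j * (V x + V y) := by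
  obtain ⟨β, ρ, hβ, hρ0, hρ1, hcon⟩ := (h.pow hn).exists_contraction hν
  set L := 1 + K / (1 - γ)
  have hL : 1 ≤ L := by
    have := div_nonneg h.K_nonneg (sub_pos.2 h.γ_lt_one).le
    simp only [L]; linarith
  have hn' : (n : ℝ) ≠ 0 := Nat.cast_ne_zero.2 hn
  -- The rate per single step. Rounding j down to a multiple of n costs at most the factor 1/ρ,
  -- because j ≤ n(j/n + 1) with integer division.
  set r := ρ ^ ((n : ℝ)⁻¹) with hr
  have hr0 : 0 < r := Real.rpow_pos_of_pos hρ0 _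
  have hr1 : r < 1 := Real.rpow_lt_one hρ0.le hρ1 (by positivity)
  have hrn : r ^ n = ρ := by rw [hr, ← Real.rpow_mul_natCast hρ0.le]; simp [hn']
  have hpow : ∀ j, ρ ^ (j / n) ≤ r ^ j / ρ := fun j => by
    rw [le_div_iff₀ hρ0, ← pow_succ]
    nth_rewrite 1 [← hrn]
    rw [← pow_mul]
    apply pow_le_pow_of_le_one hr0.le hr1.le
    have := Nat.div_add_mod j n
    have := Nat.mod_lt j (Nat.pos_of_ne_zero hn)
    rw [mul_add, mul_one]
    omega
  refine ⟨L / β / ρ * (2 + β), r, by positivity, hr0, hr1, fun φ hφ hφV j x y => ?_⟩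
  set q := j / n
  have hj : j = (j % n) + n * q := (Nat.mod_add_div j n).symm
  have hint := h.integrable_of_abs_le hφ hφV
  -- The j % n leftover steps are absorbed into the test function, which stays below L V with L
  -- independent of j; the contraction of κ ^ n then acts on ψ.
  set ψ : S → ℝ := fun y => ∫ z, φ z ∂(κ ^ (j % n)) y
  have hψ : Measurable ψ := measurable_integral _ hφ
  have hψV : ∀ x, |ψ x| ≤ L * V x := fun x => by
    refine le_trans (norm_integral_le_of_norm_le (f := φ) (h.pow_bound (j % n) x).1
      (ae_of_all _ hφV)) ?_
    refine (h.pow_bound _ x).2.trans ?_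
    have h1 : γ ^ (j % n) ≤ 1 := pow_le_one₀ h.γ_nonneg h.γ_lt_one.le
    have := h.one_le x
    have := div_nonneg h.K_nonneg (sub_pos.2 h.γ_lt_one).le
    simp only [L]
    nlinarith
  have e : ∀ x, ∫ z, φ z ∂(κ ^ j) x = ∫ y, ψ y ∂((κ ^ n) ^ q) x := fun x => by
    have hc : (κ ^ j) x = (κ ^ (j % n)) ∘ₘ (((κ ^ n) ^ q) x) := by
      conv_lhs => rw [hj, _root_.pow_add, pow_mul]
      exact Kernel.comp_apply _ _ _
    rw [hc, integral_measure_comp]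
    rw [← hc]; exact hint _ _
  rw [e, e]
  have hVL : ∀ x, 0 ≤ L * V x := fun x => mul_nonneg (by linarith) (h.pos x).le
  have hψi : ∀ k x, Integrable ψ (((κ ^ n) ^ k) x) := fun k x => by
    rw [← pow_mul]
    exact ((h.pow_bound (n * k) x).1.const_mul L).mono' hψ.aestronglyMeasurable (ae_of_all _ hψV)
  have hosc : ∀ x y, |ψ x - ψ y| ≤ L / β * (2 + β * (V x + V y)) := fun x y => by
    refine (abs_sub _ _).trans ((add_le_add (hψV x) (hψV y)).trans ?_)
    have e1 : L / β * (2 + β * (V x + V y)) = 2 * (L / β) + (L * V x + L * V y) := by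
      field_simp
    rw [e1]
    have : 0 < L / β := by positivity
    linarith
  refine (integral_pow_contraction hρ0.le hcon q hψ (by positivity) hosc hψi x y).trans ?_
  have hx := h.one_le x
  have hy := h.one_le y
  calc ρ ^ q * (L / β) * (2 + β * (V x + V y))
      ≤ (r ^ j / ρ) * (L / β) * ((2 + β) * (V x + V y)) := by
        gcongr
        · exact hpow j
        · nlinarith
    _ = _ := by ring

/-- Integrates the two-point bound over y. With μ = κ x it gives the Cauchy estimate between times j
and j + 1; with μ invariant it gives convergence to equilibrium. -/
theorem abs_integral_sub_integral_comp_le {κ : Kernel S S} [IsMarkovKernel κ]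
    {V : S → ℝ} {j : ℕ} {b : ℝ} {φ : S → ℝ} (hφ : Measurable φ)
    (hb : ∀ x y, |∫ z, φ z ∂(κ ^ j) x - ∫ z, φ z ∂(κ ^ j) y| ≤ b * (V x + V y))
    {μ : Measure S} [IsProbabilityMeasure μ] (hμ : Integrable V μ)
    (hμj : Integrable φ (μ.bind ↑(κ ^ j))) (x : S) :
    |∫ z, φ z ∂(κ ^ j) x - ∫ z, φ z ∂(μ.bind ↑(κ ^ j))| ≤ b * (V x + ∫ y, V y ∂μ) := by
  rw [integral_measure_comp hμj]
  have h0 := (Measure.integrable_comp_iff hφ.aestronglyMeasurable).1 hμj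
  have h1 : Integrable (fun y => ∫ z, φ z ∂(κ ^ j) y) μ :=
    h0.2.mono' (measurable_integral _ hφ).aestronglyMeasurable
      (ae_of_all _ fun y => norm_integral_le_integral_norm _)
  have h2 : ∫ y, (∫ z, φ z ∂(κ ^ j) x - ∫ z, φ z ∂(κ ^ j) y) ∂μ =
      ∫ z, φ z ∂(κ ^ j) x - ∫ y, ∫ z, φ z ∂(κ ^ j) y ∂μ := by
    rw [integral_sub (integrable_const _) h1]; simp
  have h3 : ∫ y, b * (V x + V y) ∂μ = b * (V x + ∫ y, V y ∂μ) := by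
    rw [integral_const_mul, integral_add (integrable_const _) hμ]; simp
  rw [← h2, ← h3]
  exact norm_integral_le_of_norm_le
    (f := fun y => ∫ z, φ z ∂(κ ^ j) x - ∫ z, φ z ∂(κ ^ j) y) (g := fun y => b * (V x + V y))
    (((integrable_const _).add hμ).const_mul b)
    (ae_of_all _ (hb x))

end ProbabilityTheory.Kernel

end

/-! ### Invariant measures: existence, uniqueness and integrability of the drift function. -/

noncomputable section

open Filter Topology

namespace ProbabilityTheory.Kernel

variable {S : Type*} [MeasurableSpace S]

/-- A uniform setwise limit of probability measures is a probability measure. -/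
theorem exists_measure_of_uniform_setwise_limit {μ : ℕ → Measure S}
    [∀ n, IsProbabilityMeasure (μ n)] {a : Set S → ℝ} {b : ℕ → ℝ} (hb : Tendsto b atTop (𝓝 0))
    (h : ∀ n s, MeasurableSet s → |(μ n).real s - a s| ≤ b n) :
    ∃ π : Measure S, IsProbabilityMeasure π ∧ ∀ s, MeasurableSet s → π.real s = a s := by
  have hlim : ∀ s, MeasurableSet s → Tendsto (fun n => (μ n).real s) atTop (𝓝 (a s)) :=
    fun s hs => tendsto_iff_dist_tendsto_zero.2
      (squeeze_zero (fun _ => dist_nonneg) (fun n => h n s hs) hb)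
  have hnn : ∀ s, MeasurableSet s → 0 ≤ a s := fun s hs =>
    ge_of_tendsto' (hlim s hs) fun n => measureReal_nonneg
  have hempty : a ∅ = 0 := tendsto_nhds_unique (hlim ∅ .empty) (by simp)
  have huniv : a Set.univ = 1 := tendsto_nhds_unique (hlim _ .univ) (by simp)
  have hfin : ∀ f : ℕ → Set S, (∀ i, MeasurableSet (f i)) → Pairwise (Function.onFun Disjoint f) →
      ∀ k, a (⋃ i ∈ Finset.range k, f i) = ∑ i ∈ Finset.range k, a (f i) := fun f hf hd k => by
    refine tendsto_nhds_unique (hlim _ (Finset.measurableSet_biUnion _ fun i _ => hf i)) ?_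
    have e : ∀ n, (μ n).real (⋃ i ∈ Finset.range k, f i) =
        ∑ i ∈ Finset.range k, (μ n).real (f i) := fun n =>
      measureReal_biUnion_finset (fun i _ j _ hij => hd hij) (fun i _ => hf i)
    simp only [e]
    exact tendsto_finsetSum _ fun i _ => hlim _ (hf i)
  have hsum : ∀ f : ℕ → Set S, (∀ i, MeasurableSet (f i)) → Pairwise (Function.onFun Disjoint f) →
      HasSum (fun i => a (f i)) (a (⋃ i, f i)) := fun f hf hd => by
    rw [hasSum_iff_tendsto_nat_of_nonneg fun i => hnn _ (hf i)]
    have hU : MeasurableSet (⋃ i, f i) := MeasurableSet.iUnion hf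
    have e : ∀ n, HasSum (fun i => (μ n).real (f i)) ((μ n).real (⋃ i, f i)) := fun n => by
      have h1 := measure_iUnion hd hf (μ := μ n)
      have h2 := ENNReal.hasSum_toReal (f := fun i => μ n (f i)) (by rw [← h1]; simp)
      rwa [← ENNReal.tsum_toReal_eq (by simp), ← h1] at h2
    -- Countable additivity survives because the convergence is uniform in the set: fix one μ n with
    -- b n < ε/3, cut its convergent series at ε/3, and compare both the union and the partial union
    -- with their limits.
    rw [Metric.tendsto_atTop]
    intro ε hε
    obtain ⟨n, hn⟩ := ((tendsto_order.1 hb).2 (ε / 3) (by positivity)).exists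
    obtain ⟨N, hN⟩ := Metric.tendsto_atTop.1 (e n).tendsto_sum_nat (ε / 3) (by positivity)
    refine ⟨N, fun k hk => ?_⟩
    have h1 := hN k hk
    have h2 := h n _ hU
    have hV : MeasurableSet (⋃ i ∈ Finset.range k, f i) :=
      Finset.measurableSet_biUnion _ fun i _ => hf i
    have h3 := h n _ hV
    rw [measureReal_biUnion_finset (fun i _ j _ hij => hd hij) (fun i _ => hf i),
      hfin f hf hd] at h3
    rw [Real.dist_eq] at h1 ⊢
    rw [abs_lt] at h1 ⊢
    rw [abs_le] at h2 h3
    constructor <;> linarith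
  let π : Measure S := Measure.ofMeasurable (fun s _ => ENNReal.ofReal (a s)) (by simp [hempty])
    (fun f hf hd => by
      rw [← (hsum f hf hd).tsum_eq]
      exact ENNReal.ofReal_tsum_of_nonneg (fun i => hnn _ (hf i)) (hsum f hf hd).summable)
  have hπ : ∀ s, MeasurableSet s → π s = ENNReal.ofReal (a s) := fun s hs =>
    Measure.ofMeasurable_apply s hs
  refine ⟨π, ⟨by rw [hπ _ .univ, huniv]; simp⟩, fun s hs => ?_⟩
  rw [measureReal_def, hπ s hs, ENNReal.toReal_ofReal (hnn s hs)]

/-- Measures that are uniformly close on sets have close integrals of `[0, 1]`-valued functions. -/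
theorem abs_integral_sub_le_of_setwise {μ ν : Measure S} [IsProbabilityMeasure μ]
    [IsProbabilityMeasure ν] {b : ℝ} (h : ∀ s, MeasurableSet s → |μ.real s - ν.real s| ≤ b)
    {φ : S → ℝ} (hφ : Measurable φ) (h0 : ∀ x, 0 ≤ φ x) (h1 : ∀ x, φ x ≤ 1) :
    |∫ x, φ x ∂μ - ∫ x, φ x ∂ν| ≤ b := by
  -- Layer-cake formula: as 0 ≤ φ ≤ 1, the integral averages the measures of superlevel sets over t
  -- in (0, 1], so a uniform setwise bound passes to it.
  have e : ∀ μ : Measure S, IsProbabilityMeasure μ →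
      ∫ x, φ x ∂μ = ∫ t in Set.Ioc (0 : ℝ) 1, μ.real {x | t ≤ φ x} := fun μ _ =>
    Integrable.integral_eq_integral_Ioc_meas_le
      ((integrable_const (1 : ℝ)).mono' hφ.aestronglyMeasurable
        (ae_of_all _ fun x => by rw [Real.norm_eq_abs, abs_of_nonneg (h0 x)]; exact h1 x))
      (ae_of_all _ h0) (ae_of_all _ h1)
  have hi : ∀ μ : Measure S, IsProbabilityMeasure μ →
      IntegrableOn (fun t => μ.real {x | t ≤ φ x}) (Set.Ioc (0 : ℝ) 1) := fun μ _ => by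
    refine Integrable.mono' (integrable_const (1 : ℝ)) ?_ (ae_of_all _ fun t => ?_)
    · refine (Antitone.measurable fun s t hst => ?_).aestronglyMeasurable
      exact measureReal_mono fun x hx => le_trans hst hx
    · rw [Real.norm_eq_abs, abs_of_nonneg measureReal_nonneg]; exact measureReal_le_one
  rw [e μ inferInstance, e ν inferInstance, ← integral_sub (hi μ inferInstance) (hi ν inferInstance)]
  have := norm_integral_le_of_norm_le (μ := volume.restrict (Set.Ioc (0 : ℝ) 1))
    (f := fun t => μ.real {x | t ≤ φ x} - ν.real {x | t ≤ φ x}) (g := fun _ => b) (integrable_const _)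
    (ae_of_all _ fun t => h _ (measurableSet_le measurable_const hφ))
  simpa using this

/-- Existence of an invariant probability measure from weighted geometric ergodicity. -/
theorem DriftCondition.exists_invariant [Nonempty S] {κ : Kernel S S} [IsMarkovKernel κ]
    {V : S → ℝ} {γ K : ℝ} (h : DriftCondition κ V γ K) {C ρ : ℝ} (hρ0 : 0 < ρ)
    (hρ1 : ρ < 1)
    (hgeo : ∀ φ : S → ℝ, Measurable φ → (∀ x, |φ x| ≤ V x) →
      ∀ j x y, |∫ z, φ z ∂(κ ^ j) x - ∫ z, φ z ∂(κ ^ j) y| ≤ C * ρ ^ j * (V x + V y)) :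
    ∃ π : Measure S, IsProbabilityMeasure π ∧ Invariant κ π := by
  obtain ⟨x⟩ := ‹Nonempty S›
  have hstep : ∀ s, MeasurableSet s → ∀ j,
      |((κ ^ j) x).real s - ((κ ^ (j + 1)) x).real s| ≤ C * (V x + ∫ y, V y ∂κ x) * ρ ^ j :=
    fun s hs j => by
    have hm : Measurable (s.indicator fun _ => (1 : ℝ)) := measurable_const.indicator hs
    have hle : ∀ y, |s.indicator (fun _ => (1 : ℝ)) y| ≤ V y := fun y => by
      refine le_trans ?_ (h.one_le y)
      by_cases hy : y ∈ s <;> simp [hy]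
    have := abs_integral_sub_integral_comp_le hm (hgeo _ hm hle j) (h.integrable x)
      (by rw [← pow_succ_apply]; exact h.integrable_of_abs_le hm hle _ _) x
    rw [← pow_succ_apply, integral_indicator_const _ hs, integral_indicator_const _ hs] at this
    simp only [smul_eq_mul, mul_one] at this
    calc _ ≤ _ := this
      _ = _ := by ring
  choose! a ha using fun s (hs : MeasurableSet s) => cauchySeq_tendsto_of_complete
    (cauchySeq_of_le_geometric ρ _ hρ1 fun j => by rw [Real.dist_eq]; exact hstep s hs j)
  set b : ℕ → ℝ := fun j => C * (V x + ∫ y, V y ∂κ x) * ρ ^ j / (1 - ρ)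
  have hb : Tendsto b atTop (𝓝 0) := by
    have := ((tendsto_pow_atTop_nhds_zero_of_lt_one hρ0.le hρ1).const_mul
      (C * (V x + ∫ y, V y ∂κ x))).div_const (1 - ρ)
    simpa using this
  have hab : ∀ j s, MeasurableSet s → |((κ ^ j) x).real s - a s| ≤ b j := fun j s hs =>
    dist_le_of_le_geometric_of_tendsto ρ _ hρ1
      (fun j => by rw [Real.dist_eq]; exact hstep s hs j) (ha s hs) j
  obtain ⟨π, hπ, hπa⟩ := exists_measure_of_uniform_setwise_limit hb hab
  refine ⟨π, hπ, ?_⟩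
  have hcl : ∀ j s, MeasurableSet s → |((κ ^ j) x).real s - π.real s| ≤ b j := fun j s hs => by
    rw [hπa s hs]; exact hab j s hs
  ext s hs
  have hm : Measurable fun y => (κ y).real s := (κ.measurable_coe hs).ennreal_toReal
  have hreal : ∀ μ : Measure S, IsProbabilityMeasure μ →
      (μ.bind κ).real s = ∫ y, (κ y).real s ∂μ := fun μ _ => by
    rw [measureReal_def, Measure.bind_apply hs κ.aemeasurable]
    exact (integral_toReal (κ.measurable_coe hs).aemeasurable (ae_of_all _ fun y =>
      measure_lt_top _ _)).symm
  -- The integrand is merely measurable with values in [0, 1]; uniform setwise convergence is strong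
  -- enough to pass to the limit without a Feller property.
  have h1 : Tendsto (fun j => ∫ y, (κ y).real s ∂(κ ^ j) x) atTop
      (𝓝 (∫ y, (κ y).real s ∂π)) :=
    tendsto_iff_dist_tendsto_zero.2 (squeeze_zero (fun _ => dist_nonneg) (fun j =>
      abs_integral_sub_le_of_setwise (hcl j) hm (fun _ => measureReal_nonneg)
        fun _ => measureReal_le_one) hb)
  have h2 : Tendsto (fun j => ((κ ^ (j + 1)) x).real s) atTop (𝓝 (π.real s)) := by
    rw [hπa s hs]; exact (ha s hs).comp (tendsto_add_atTop_nat 1)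
  have h3 : (π.bind κ).real s = π.real s := by
    rw [hreal π hπ]
    refine tendsto_nhds_unique h1 (h2.congr fun j => ?_)
    rw [pow_succ_apply', hreal _ inferInstance]
  have : IsProbabilityMeasure (π.bind κ) := inferInstance
  exact (measureReal_eq_measureReal_iff).1 h3

theorem integral_comp_pow_of_invariant {κ : Kernel S S} [IsMarkovKernel κ] {μ : Measure S}
    (hμ : Invariant κ μ) (j : ℕ) {φ : S → ℝ} (hφ : Integrable φ μ) :
    ∫ x, φ x ∂μ = ∫ x, ∫ y, φ y ∂(κ ^ j) x ∂μ := by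
  have e : μ.bind ↑(κ ^ j) = μ := hμ.pow j
  conv_lhs => rw [← e]
  exact integral_measure_comp (by rwa [e])

/-- The drift function is integrable under every invariant probability measure. -/
theorem DriftCondition.integrable_invariant {κ : Kernel S S} [IsMarkovKernel κ]
    {V : S → ℝ} {γ K : ℝ} (h : DriftCondition κ V γ K) {μ : Measure S} [IsProbabilityMeasure μ]
    (hμ : Invariant κ μ) : Integrable V μ := by
  set L := K / (1 - γ)
  have hL : 0 ≤ L := div_nonneg h.K_nonneg (sub_pos.2 h.γ_lt_one).le
  have hm : ∀ n : ℕ, Measurable fun x => min (V x) (n : ℝ) := fun n => h.measurable.min measurable_const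
  have hnn : ∀ (n : ℕ) x, 0 ≤ min (V x) (n : ℝ) := fun n x =>
    le_min (h.pos x).le (Nat.cast_nonneg n)
  have habs : ∀ (n : ℕ) x, |min (V x) (n : ℝ)| ≤ n := fun n x => by
    rw [abs_of_nonneg (hnn n x)]; exact min_le_right _ _
  have hi : ∀ (n : ℕ) (ν : Measure S), IsProbabilityMeasure ν →
      Integrable (fun x => min (V x) (n : ℝ)) ν := fun n ν _ =>
    (integrable_const (n : ℝ)).mono' (hm n).aestronglyMeasurable (ae_of_all _ (habs n))
  -- The truncation is bounded, so invariance applies before V is known to be integrable. Letting j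
  -- → ∞ by dominated convergence removes γ ^ j V and leaves a bound independent of n; Fatou's lemma
  -- then removes the truncation.
  have key : ∀ n : ℕ, ∫ x, min (V x) (n : ℝ) ∂μ ≤ L := fun n => by
    have hle : ∀ j, ∫ x, min (V x) (n : ℝ) ∂μ ≤ ∫ x, min (γ ^ j * V x + L) (n : ℝ) ∂μ :=
      fun j => by
      rw [integral_comp_pow_of_invariant hμ j (hi n μ inferInstance)]
      refine integral_mono_of_nonneg (ae_of_all _ fun x => integral_nonneg (hnn n)) ?_
        (ae_of_all _ fun x => le_min ?_ ?_)
      · refine (integrable_const (n : ℝ)).mono'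
          ((h.measurable.const_mul _).add_const _ |>.min measurable_const).aestronglyMeasurable
          (ae_of_all _ fun x => ?_)
        have := h.pos x
        have := h.γ_nonneg
        rw [Real.norm_eq_abs, abs_of_nonneg (le_min (by positivity) (Nat.cast_nonneg n))]
        exact min_le_right _ _
      · exact (integral_mono (hi n _ inferInstance) (h.pow_bound j x).1
          fun y => min_le_left _ _).trans (h.pow_bound j x).2
      · simpa using integral_mono (hi n ((κ ^ j) x) inferInstance) (integrable_const (n : ℝ))
          fun y => min_le_right _ _
    have hlim : Tendsto (fun j : ℕ => ∫ x, min (γ ^ j * V x + L) (n : ℝ) ∂μ) atTop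
        (𝓝 (∫ _, min L (n : ℝ) ∂μ)) := by
      refine tendsto_integral_of_dominated_convergence (fun _ => (n : ℝ))
        (fun j => ((h.measurable.const_mul _).add_const _ |>.min measurable_const).aestronglyMeasurable)
        (integrable_const _) (fun j => ae_of_all _ fun x => ?_) (ae_of_all _ fun x => ?_)
      · have := h.pos x
        have := h.γ_nonneg
        rw [Real.norm_eq_abs, abs_of_nonneg (le_min (by positivity) (Nat.cast_nonneg n))]
        exact min_le_right _ _
      · have := (((tendsto_pow_atTop_nhds_zero_of_lt_one h.γ_nonneg h.γ_lt_one).mul_const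
          (V x)).add_const L).min (tendsto_const_nhds (x := (n : ℝ)))
        simpa using this
    refine (ge_of_tendsto' hlim hle).trans ?_
    simp
  refine ⟨h.measurable.aestronglyMeasurable, ?_⟩
  rw [hasFiniteIntegral_iff_ofReal (ae_of_all _ fun x => (h.pos x).le)]
  have hF : ∫⁻ x, ENNReal.ofReal (V x) ∂μ ≤
      liminf (fun n : ℕ => ∫⁻ x, ENNReal.ofReal (min (V x) (n : ℝ)) ∂μ) atTop := by
    refine le_trans (lintegral_mono fun x => ?_)
      (lintegral_liminf_le fun n => (hm n).ennreal_ofReal)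
    refine (Tendsto.liminf_eq ?_).ge
    refine tendsto_const_nhds.congr' ?_
    filter_upwards [eventually_ge_atTop ⌈V x⌉₊] with n hn
    rw [min_eq_left (Nat.ceil_le.1 hn)]
  refine (hF.trans ?_).trans_lt (ENNReal.ofReal_lt_top (r := L))
  refine liminf_le_of_le (by isBoundedDefault) fun b hb => ?_
  obtain ⟨n, hn⟩ := hb.exists
  refine hn.trans ?_
  rw [← ofReal_integral_eq_lintegral_ofReal (hi n μ inferInstance) (ae_of_all _ (hnn n))]
  exact ENNReal.ofReal_le_ofReal (key n)

theorem DriftCondition.abs_integral_sub_invariant_le {κ : Kernel S S} [IsMarkovKernel κ]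
    {V : S → ℝ} {γ K : ℝ} (h : DriftCondition κ V γ K) {j : ℕ} {b : ℝ} {φ : S → ℝ}
    (hφ : Measurable φ) (hφV : ∀ x, |φ x| ≤ V x)
    (hb : ∀ x y, |∫ z, φ z ∂(κ ^ j) x - ∫ z, φ z ∂(κ ^ j) y| ≤ b * (V x + V y))
    {μ : Measure S} [IsProbabilityMeasure μ] (hμ : Invariant κ μ) (x : S) :
    |∫ z, φ z ∂(κ ^ j) x - ∫ z, φ z ∂μ| ≤ b * (V x + ∫ y, V y ∂μ) := by
  have hi := h.integrable_invariant hμ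
  have e : μ.bind ↑(κ ^ j) = μ := hμ.pow j
  have := abs_integral_sub_integral_comp_le hφ hb hi
    (by rw [e]; exact hi.mono' hφ.aestronglyMeasurable (ae_of_all _ hφV)) x
  rwa [e] at this

/-- Every invariant probability measure is the setwise limit of the same sequence of laws started at
one fixed point. -/
theorem DriftCondition.invariant_unique [Nonempty S] {κ : Kernel S S} [IsMarkovKernel κ]
    {V : S → ℝ} {γ K : ℝ} (h : DriftCondition κ V γ K) {C ρ : ℝ} (hρ0 : 0 < ρ)
    (hρ1 : ρ < 1)
    (hgeo : ∀ φ : S → ℝ, Measurable φ → (∀ x, |φ x| ≤ V x) →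
      ∀ j x y, |∫ z, φ z ∂(κ ^ j) x - ∫ z, φ z ∂(κ ^ j) y| ≤ C * ρ ^ j * (V x + V y))
    {μ π : Measure S} [IsProbabilityMeasure μ] [IsProbabilityMeasure π] (hμ : Invariant κ μ)
    (hπ : Invariant κ π) : μ = π := by
  obtain ⟨x⟩ := ‹Nonempty S›
  ext s hs
  refine (measureReal_eq_measureReal_iff).1 ?_
  have hm : Measurable (s.indicator fun _ => (1 : ℝ)) := measurable_const.indicator hs
  have hle : ∀ y, |s.indicator (fun _ => (1 : ℝ)) y| ≤ V y := fun y => by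
    refine le_trans ?_ (h.one_le y)
    by_cases hy : y ∈ s <;> simp [hy]
  have lim : ∀ ν : Measure S, IsProbabilityMeasure ν → Invariant κ ν →
      Tendsto (fun j => ((κ ^ j) x).real s) atTop (𝓝 (ν.real s)) := fun ν _ hν => by
    have hb : Tendsto (fun j => C * ρ ^ j * (V x + ∫ y, V y ∂ν)) atTop (𝓝 0) := by
      have := ((tendsto_pow_atTop_nhds_zero_of_lt_one hρ0.le hρ1).const_mul C).mul_const
        (V x + ∫ y, V y ∂ν)
      simpa using this
    refine tendsto_iff_dist_tendsto_zero.2 (squeeze_zero (fun _ => dist_nonneg) (fun j => ?_) hb)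
    have := h.abs_integral_sub_invariant_le hm hle (hgeo _ hm hle j) hν x
    rw [integral_indicator_const _ hs, integral_indicator_const _ hs] at this
    simpa using! this
  exact tendsto_nhds_unique (lim μ inferInstance hμ) (lim π inferInstance hπ)

end ProbabilityTheory.Kernel

end

/-! ### Matrix exponentials in weighted ℓ¹ norms. -/

noncomputable section

open Filter Topology

section MatrixExp

variable {ι : Type*} [Fintype ι]

theorem Matrix.sum_mul_abs_mulVec_le {K : Matrix ι ι ℝ} {w : ι → ℝ} (hw : ∀ i, 0 ≤ w i) {θ : ℝ}
    (hcol : ∀ l, ∑ i, w i * |K i l| ≤ θ * w l) (x : ι → ℝ) :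
    ∑ i, w i * |K.mulVec x i| ≤ θ * ∑ i, w i * |x i| :=
  calc ∑ i, w i * |K.mulVec x i| ≤ ∑ i, w i * ∑ l, |K i l| * |x l| := by
        refine Finset.sum_le_sum fun i _ => mul_le_mul_of_nonneg_left ?_ (hw i)
        refine (Finset.abs_sum_le_sum_abs _ _).trans_eq ?_
        simp only [abs_mul]
    _ = ∑ l, (∑ i, w i * |K i l|) * |x l| := by
        simp only [Finset.mul_sum, Finset.sum_mul]
        rw [Finset.sum_comm]
        exact Finset.sum_congr rfl fun l _ => Finset.sum_congr rfl fun i _ => by ring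
    _ ≤ ∑ l, θ * w l * |x l| :=
        Finset.sum_le_sum fun l _ => mul_le_mul_of_nonneg_right (hcol l) (abs_nonneg _)
    _ = _ := by rw [Finset.mul_sum]; exact Finset.sum_congr rfl fun l _ => by ring

variable [DecidableEq ι]

open scoped Nat in
theorem Matrix.hasSum_exp_smul_mulVec (A : Matrix ι ι ℝ) (t : ℝ) (x : ι → ℝ) :
    HasSum (fun n : ℕ => (t ^ n / (n ! : ℝ)) • (A ^ n).mulVec x)
      ((NormedSpace.exp (t • A)).mulVec x) := by
  let := Matrix.linftyOpNormedRing (n := ι) (α := ℝ)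
  let := Matrix.linftyOpNormedAlgebra (R := ℝ) (n := ι) (α := ℝ)
  have h := NormedSpace.exp_series_hasSum_exp' (𝕂 := ℝ) (t • A)
  let L : Matrix ι ι ℝ →ₗ[ℝ] (ι → ℝ) := (Matrix.mulVecBilin ℝ ℝ).flip x
  have h2 := h.mapL (LinearMap.toContinuousLinearMap L)
  convert! h2 using 2 with n
  simp only [L, LinearMap.coe_toContinuousLinearMap', map_smul, smul_pow, smul_smul]
  rw [div_eq_inv_mul]
  rfl

/-- Scalar matrices commute with A. The shift serves twice: to make the drift matrix entrywise
nonnegative, and to make one of its blocks nilpotent. -/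
theorem Matrix.exp_smul_add_smul_one (A : Matrix ι ι ℝ) (t c : ℝ) :
    NormedSpace.exp (t • (A + c • (1 : Matrix ι ι ℝ))) =
      Real.exp (t * c) • NormedSpace.exp (t • A) := by
  rw [smul_add, Matrix.exp_add_of_commute _ _ (by
    rw [smul_smul]; exact (Commute.one_right _).smul_right _)]
  have : NormedSpace.exp (t • c • (1 : Matrix ι ι ℝ)) = Real.exp (t * c) • 1 := by
    rw [smul_smul, Matrix.smul_one_eq_diagonal, Matrix.exp_diagonal, Matrix.smul_one_eq_diagonal]
    congr 1
    ext i
    rw [Pi.coe_exp, Real.exp_eq_exp_ℝ]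
  rw [this, mul_smul_comm, mul_one]

/-- A weighted column-sum bound on `K` passes to the matrix exponential. -/
theorem Matrix.sum_mul_abs_exp_mulVec_le {K : Matrix ι ι ℝ} {w : ι → ℝ} (hw : ∀ i, 0 ≤ w i)
    {θ : ℝ} (hθ : 0 ≤ θ) (hcol : ∀ l, ∑ i, w i * |K i l| ≤ θ * w l) {t : ℝ} (ht : 0 ≤ t)
    (x : ι → ℝ) :
    ∑ i, w i * |(NormedSpace.exp (t • K)).mulVec x i| ≤ Real.exp (t * θ) * ∑ i, w i * |x i| := by
  set q : (ι → ℝ) → ℝ := fun x => ∑ i, w i * |x i| with hq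
  have hq0 : ∀ x, 0 ≤ q x := fun x =>
    Finset.sum_nonneg fun i _ => mul_nonneg (hw i) (abs_nonneg _)
  have hqc : Continuous q := by fun_prop
  have hpow : ∀ n, q ((K ^ n).mulVec x) ≤ θ ^ n * q x := fun n => by
    induction n with
    | zero => simp
    | succ n ih =>
      rw [pow_succ', ← Matrix.mulVec_mulVec]
      refine (Matrix.sum_mul_abs_mulVec_le hw hcol _).trans ?_
      rw [pow_succ', mul_assoc]
      exact mul_le_mul_of_nonneg_left ih hθ
  have hsum : ∀ (s : Finset ℕ) (v : ℕ → ι → ℝ), q (∑ n ∈ s, v n) ≤ ∑ n ∈ s, q (v n) :=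
    fun s v => by
    simp only [hq]
    rw [Finset.sum_comm]
    refine Finset.sum_le_sum fun i _ => ?_
    rw [← Finset.mul_sum, Finset.sum_apply]
    exact mul_le_mul_of_nonneg_left (Finset.abs_sum_le_sum_abs _ _) (hw i)
  have hsmul : ∀ (c : ℝ), 0 ≤ c → ∀ y, q (c • y) = c * q y := fun c hc y => by
    simp only [hq, Pi.smul_apply, smul_eq_mul, abs_mul, abs_of_nonneg hc, Finset.mul_sum]
    exact Finset.sum_congr rfl fun i _ => by ring
  refine le_of_tendsto ((hqc.tendsto _).comp (Matrix.hasSum_exp_smul_mulVec K t x))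
    (Eventually.of_forall fun s => ?_)
  refine (hsum s _).trans ?_
  calc ∑ n ∈ s, q ((t ^ n / (n.factorial : ℝ)) • (K ^ n).mulVec x)
      ≤ ∑ n ∈ s, (t * θ) ^ n / (n.factorial : ℝ) * q x := by
        refine Finset.sum_le_sum fun n _ => ?_
        rw [hsmul _ (by positivity), mul_pow, mul_div_right_comm, mul_assoc]
        exact mul_le_mul_of_nonneg_left (hpow n) (by positivity)
    _ = (∑ n ∈ s, (t * θ) ^ n / (n.factorial : ℝ)) * q x := by rw [Finset.sum_mul]
    _ ≤ Real.exp (t * θ) * q x := by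
        refine mul_le_mul_of_nonneg_right ?_ (hq0 x)
        rw [Real.exp_eq_exp_ℝ, NormedSpace.exp_eq_tsum_div]
        exact Summable.sum_le_tsum s (fun n _ => by positivity)
          (NormedSpace.expSeries_div_summable (t * θ))

end MatrixExp

/-! ### The Lyapunov function and its decay under the linear flow. -/

namespace HawkesModel

variable (M : HawkesModel)

/-- The weights of the Lyapunov function. -/
def weight (i : M.Idx) : ℝ := ((i.2 : ℝ) + 1) / M.ν i.1 ^ (i.2 : ℕ)

theorem weight_pos (i : M.Idx) : 0 < M.weight i := by
  have := M.ν_pos i.1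
  unfold weight
  positivity

theorem lyapunov_eq_sum (x : M.State) : M.lyapunov x = ∑ i, M.weight i * |x i| := by
  rw [Fintype.sum_sigma]; rfl

theorem lyapunov_nonneg (x : M.State) : 0 ≤ M.lyapunov x := by
  rw [lyapunov_eq_sum]
  exact Finset.sum_nonneg fun i _ => mul_nonneg (M.weight_pos i).le (abs_nonneg _)

theorem lyapunov_add_le (x y : M.State) : M.lyapunov (x + y) ≤ M.lyapunov x + M.lyapunov y := by
  simp only [lyapunov_eq_sum, ← Finset.sum_add_distrib, ← mul_add]
  exact Finset.sum_le_sum fun i _ =>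
    mul_le_mul_of_nonneg_left (abs_add_le _ _) (M.weight_pos i).le

theorem measurable_lyapunov : Measurable M.lyapunov := by
  have : Continuous M.lyapunov := by unfold lyapunov; fun_prop
  exact this.measurable

theorem weight_mul_abs_le_lyapunov (x : M.State) (i : M.Idx) :
    M.weight i * |x i| ≤ M.lyapunov x := by
  rw [lyapunov_eq_sum]
  exact Finset.single_le_sum (f := fun i => M.weight i * |x i|)
    (fun i _ => mul_nonneg (M.weight_pos i).le (abs_nonneg _)) (Finset.mem_univ i)

theorem A_apply (i l : M.Idx) :
    M.A i l = if i = l then -M.ν i.1 else if i.1 = l.1 ∧ (i.2 : ℕ) + 1 = l.2 then 1 else 0 := by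
  obtain ⟨k, i⟩ := i
  obtain ⟨k', l⟩ := l
  by_cases hk : k = k'
  · subst hk
    simp [A, blockA]
  · rw [A, Matrix.blockDiagonal'_apply_ne _ _ _ hk]
    simp [hk]

/-- In the numbering from 1, column j has at most one off-diagonal entry, in row j - 1, and the
weight ratio is ν(j - 1)/j ≤ ν - ν/(η + 1). The strict gain comes from the numerators j: with
weights 1/ν^(j-1) the ratio would be exactly ν and cancel the diagonal. -/
theorem sum_weight_upper_le (l : M.Idx) :
    ∑ i : M.Idx, M.weight i * (if i.1 = l.1 ∧ (i.2 : ℕ) + 1 = l.2 then 1 else 0) ≤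
      (M.ν l.1 - M.ν l.1 / (M.η l.1 + 1)) * M.weight l := by
  have hν := M.ν_pos l.1
  have hη : (0 : ℝ) ≤ M.η l.1 := Nat.cast_nonneg _
  have h0 : 0 ≤ M.ν l.1 - M.ν l.1 / (M.η l.1 + 1) := by
    rw [sub_nonneg, div_le_iff₀ (by positivity)]; nlinarith
  obtain ⟨k, l⟩ := l
  simp only at *
  rcases Nat.eq_zero_or_pos (l : ℕ) with hl | hl
  · rw [Finset.sum_eq_zero fun i _ => by simp [hl]]
    exact mul_nonneg h0 (M.weight_pos _).le
  · have hlt := l.2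
    rw [Finset.sum_eq_single (⟨k, ⟨l - 1, by omega⟩⟩ : M.Idx)]
    · simp only [weight, true_and]
      rw [if_pos (by omega), mul_one]
      obtain ⟨j, hj⟩ : ∃ j, (l : ℕ) = j + 1 := ⟨l - 1, by omega⟩
      have hjη : (j : ℝ) + 1 ≤ M.η k := by
        have : j + 1 ≤ M.η k := by omega
        exact_mod_cast this
      simp only [hj, Nat.add_sub_cancel]
      push_cast
      rw [pow_succ]
      have e : (M.ν k - M.ν k / (M.η k + 1)) * (((j : ℝ) + 1 + 1) / (M.ν k ^ j * M.ν k)) =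
        (M.η k * (j + 2) / (M.η k + 1)) / M.ν k ^ j := by
        field_simp
        ring
      rw [e]
      gcongr
      rw [le_div_iff₀ (by positivity)]
      nlinarith
    · rintro ⟨k', i⟩ _ hne
      rw [if_neg, mul_zero]
      rintro ⟨rfl, h⟩
      apply hne
      congr 1
      ext
      simp only at h ⊢
      omega
    · simp

/-- The linear flow is a strict contraction for the Lyapunov function. -/
theorem exists_lyapunov_flow₁_le {Δ : ℝ} (hΔ : 0 < Δ) :
    ∃ θ : ℝ, 0 < θ ∧ θ < 1 ∧ ∀ x, M.lyapunov (M.flow₁ Δ x) ≤ θ * M.lyapunov x := by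
  -- Any c above both decay rates makes A + c entrywise nonnegative, so its absolute column sums
  -- keep the negative diagonal: they are at most c - δ. Undoing the shift leaves the factor
  -- exp(-Δδ).
  set c := M.ν 0 + M.ν 1 with hc
  have hν := M.ν_pos
  have hcν : ∀ k, M.ν k ≤ c := fun k => by
    fin_cases k
    · exact le_add_of_nonneg_right (hν 1).le
    · exact le_add_of_nonneg_left (hν 0).le
  set d : Fin 2 → ℝ := fun k => M.ν k / (M.η k + 1) with hd
  have hd0 : ∀ k, 0 < d k := fun k => by have := hν k; simp only [hd]; positivity
  have hdν : ∀ k, d k ≤ M.ν k := fun k => by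
    rw [hd, div_le_iff₀ (by positivity)]
    have : (0 : ℝ) ≤ M.η k := Nat.cast_nonneg _
    have := hν k
    nlinarith
  set δ := min (d 0) (d 1) with hδ
  have hδ0 : 0 < δ := lt_min (hd0 0) (hd0 1)
  have hδd : ∀ k, δ ≤ d k := fun k => by
    fin_cases k
    · exact min_le_left _ _
    · exact min_le_right _ _
  have hδc : 0 ≤ c - δ := sub_nonneg.2 ((hδd 0).trans ((hdν 0).trans (hcν 0)))
  have hcol : ∀ l, ∑ i, M.weight i * |(M.A + c • (1 : Matrix M.Idx M.Idx ℝ)) i l| ≤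
      (c - δ) * M.weight l := fun l => by
    have e : ∀ i, M.weight i * |(M.A + c • (1 : Matrix M.Idx M.Idx ℝ)) i l| =
        (if i = l then (c - M.ν l.1) * M.weight l else 0) +
          M.weight i * (if i.1 = l.1 ∧ (i.2 : ℕ) + 1 = l.2 then 1 else 0) := fun i => by
      rw [Matrix.add_apply, A_apply, Matrix.smul_apply, Matrix.one_apply]
      by_cases h : i = l
      · subst h
        have := hcν i.1
        simp only [if_true, smul_eq_mul, mul_one]
        rw [abs_of_nonneg (by linarith), if_neg (by omega)]
        ring
      · simp only [h, if_false, smul_zero, add_zero, zero_add]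
        split_ifs <;> simp
    simp only [e]
    rw [Finset.sum_add_distrib, Finset.sum_ite_eq' Finset.univ l, if_pos (Finset.mem_univ _)]
    have h1 := M.sum_weight_upper_le l
    have h2 := mul_le_mul_of_nonneg_right (hδd l.1) (M.weight_pos l).le
    simp only [hd] at h2
    linarith
  have hexp : ∀ x, M.flow₁ Δ x = Real.exp (-(Δ * c)) •
      (NormedSpace.exp (Δ • (M.A + c • (1 : Matrix M.Idx M.Idx ℝ)))).mulVec x := fun x => by
    rw [Matrix.exp_smul_add_smul_one, Matrix.smul_mulVec, smul_smul, ← Real.exp_add]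
    simp [flow₁]
  refine ⟨Real.exp (-(Δ * δ)), Real.exp_pos _, ?_, fun x => ?_⟩
  · rw [Real.exp_lt_one_iff]
    have := mul_pos hΔ hδ0
    linarith
  · have := Matrix.sum_mul_abs_exp_mulVec_le (fun i => (M.weight_pos i).le) hδc hcol hΔ.le x
    rw [lyapunov_eq_sum, lyapunov_eq_sum, hexp]
    simp only [Pi.smul_apply, smul_eq_mul, abs_mul, abs_of_pos (Real.exp_pos _)]
    calc _ = Real.exp (-(Δ * c)) * ∑ i, M.weight i *
          |(NormedSpace.exp (Δ • (M.A + c • (1 : Matrix M.Idx M.Idx ℝ)))).mulVec x i| := by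
          rw [Finset.mul_sum]; exact Finset.sum_congr rfl fun i _ => by ring
      _ ≤ Real.exp (-(Δ * c)) * (Real.exp (Δ * (c - δ)) * ∑ i, M.weight i * |x i|) := by gcongr
      _ = _ := by
        rw [← mul_assoc, ← Real.exp_add]
        congr 2
        ring

end HawkesModel

end

/-! ### Controllability of the linear system. -/

noncomputable section

open Filter Topology

namespace HawkesModel

variable (M : HawkesModel)

/-- The directions in which noise enters: `u (k + 1)` acts on the last coordinate of block `k`. -/
def kick : (Fin 2 → ℝ) →ₗ[ℝ] M.State where
  toFun u i := if i.2 = Fin.last (M.η i.1) then u (i.1 + 1) else 0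
  map_add' u v := by ext i; by_cases h : i.2 = Fin.last (M.η i.1) <;> simp [h]
  map_smul' c u := by ext i; by_cases h : i.2 = Fin.last (M.η i.1) <;> simp [h]

theorem kick_apply (u : Fin 2 → ℝ) (i : M.Idx) :
    M.kick u i = if i.2 = Fin.last (M.η i.1) then u (i.1 + 1) else 0 := rfl

/-- The flow of the linear subsystem as a linear map. -/
def linFlow (Δ : ℝ) : M.State →ₗ[ℝ] M.State := Matrix.mulVecLin (NormedSpace.exp (Δ • M.A))

theorem linFlow_apply (Δ : ℝ) (x : M.State) : M.linFlow Δ x = M.flow₁ Δ x := rfl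

/-- The state reached from `0` after `n` steps of the linear system with controls `w`. -/
def steer (Δ : ℝ) : ℕ → (ℕ → Fin 2 → ℝ) →ₗ[ℝ] M.State
  | 0 => 0
  | n + 1 => M.linFlow Δ ∘ₗ (steer Δ n + M.kick ∘ₗ LinearMap.proj n)

theorem steer_zero (Δ : ℝ) (w : ℕ → Fin 2 → ℝ) : M.steer Δ 0 w = 0 := rfl

theorem steer_succ (Δ : ℝ) (n : ℕ) (w : ℕ → Fin 2 → ℝ) :
    M.steer Δ (n + 1) w = M.linFlow Δ (M.steer Δ n w + M.kick (w n)) := rfl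

theorem steer_congr (Δ : ℝ) {n : ℕ} {w w' : ℕ → Fin 2 → ℝ} (h : ∀ i < n, w i = w' i) :
    M.steer Δ n w = M.steer Δ n w' := by
  induction n with
  | zero => rfl
  | succ n ih =>
    rw [steer_succ, steer_succ, ih fun i hi => h i (by omega), h n (by omega)]

/-- The origin is fixed by the uncontrolled flow, so a leading zero control only delays the start.
Hence the reachable subspaces increase with n. -/
theorem steer_succ_shift (Δ : ℝ) (n : ℕ) (w : ℕ → Fin 2 → ℝ) :
    M.steer Δ (n + 1) (fun i => Nat.casesOn i 0 w) = M.steer Δ n w := by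
  induction n with
  | zero => simp [steer_succ, steer_zero]
  | succ n ih => rw [steer_succ, ih, steer_succ]

theorem linFlow_pow (Δ : ℝ) (j : ℕ) (x : M.State) :
    (M.linFlow Δ ^ j) x = (NormedSpace.exp ((j * Δ : ℝ) • M.A)).mulVec x := by
  rw [mul_smul, Nat.cast_smul_eq_nsmul ℝ, Matrix.exp_nsmul]
  induction j with
  | zero => simp
  | succ j ih => rw [pow_succ', Module.End.mul_apply, ih, pow_succ', ← Matrix.mulVec_mulVec]; rfl

/-- The chain of unit vectors of block `k`, from the last coordinate down. -/
def chain (k : Fin 2) (i : ℕ) : M.State :=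
  if i ≤ M.η k then Pi.single ⟨k, Fin.ofNat _ (M.η k - i)⟩ 1 else 0

/-- On block k the shifted matrix is the nilpotent upper shift, which moves each unit vector one
coordinate up and kills the first one. -/
theorem mulVec_chain (k : Fin 2) (i : ℕ) :
    (M.A + M.ν k • (1 : Matrix M.Idx M.Idx ℝ)).mulVec (M.chain k i) = M.chain k (i + 1) := by
  unfold chain
  by_cases hi : i ≤ M.η k
  · rw [if_pos hi, Matrix.mulVec_single_one]
    ext ⟨k', l⟩
    have hv : ((Fin.ofNat (M.η k + 1) (M.η k - i) : Fin (M.η k + 1)) : ℕ) = M.η k - i :=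
      Nat.mod_eq_of_lt (by omega)
    simp only [Matrix.col_apply, Matrix.add_apply, A_apply, Matrix.smul_apply, Matrix.one_apply,
      hv]
    by_cases hk : k' = k
    · subst hk
      by_cases hl : (l : ℕ) = M.η k' - i
      · have e : l = Fin.ofNat (M.η k' + 1) (M.η k' - i) := Fin.ext (by rw [hv, hl])
        rw [← e]
        simp only [if_true, smul_eq_mul, mul_one, neg_add_cancel]
        split_ifs with h
        · rw [Pi.single_eq_of_ne]
          rintro h'
          have := congrArg (fun i : Fin _ => (i : ℕ)) (eq_of_heq (Sigma.mk.inj h').2)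
          simp only [Fin.val_ofNat] at this
          rw [Nat.mod_eq_of_lt (by omega)] at this
          omega
        · rfl
      · have e : (⟨k', l⟩ : M.Idx) ≠ ⟨k', Fin.ofNat (M.η k' + 1) (M.η k' - i)⟩ := fun h => by
          have := congrArg (fun i : Fin _ => (i : ℕ)) (eq_of_heq (Sigma.mk.inj h).2)
          simp only [hv] at this
          exact hl this
        rw [if_neg e, if_neg e, smul_zero, add_zero]
        by_cases h : (l : ℕ) + 1 = M.η k' - i
        · have hv' : ((Fin.ofNat (M.η k' + 1) (M.η k' - (i + 1)) : Fin (M.η k' + 1)) : ℕ) =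
            M.η k' - (i + 1) := Nat.mod_eq_of_lt (by omega)
          rw [if_pos ⟨rfl, h⟩, if_pos (by omega)]
          have : l = Fin.ofNat (M.η k' + 1) (M.η k' - (i + 1)) := Fin.ext (by rw [hv']; omega)
          rw [← this, Pi.single_eq_same]
        · rw [if_neg (by tauto)]
          split_ifs with h2
          · rw [Pi.single_eq_of_ne]
            intro h'
            have := congrArg (fun i : Fin _ => (i : ℕ)) (eq_of_heq (Sigma.mk.inj h').2)
            simp only [Fin.val_ofNat] at this
            rw [Nat.mod_eq_of_lt (by omega)] at this
            omega
          · rfl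
    · have e : ∀ j, (⟨k', l⟩ : M.Idx) ≠ ⟨k, j⟩ := fun j h => hk (Sigma.mk.inj h).1
      rw [if_neg (e _), if_neg (by tauto), if_neg (e _)]
      split_ifs
      · rw [Pi.single_eq_of_ne (e _)]; simp
      · simp
  · rw [if_neg hi, if_neg (by omega), Matrix.mulVec_zero]

theorem pow_mulVec_chain (k : Fin 2) (n : ℕ) :
    ((M.A + M.ν k • (1 : Matrix M.Idx M.Idx ℝ)) ^ n).mulVec (M.chain k 0) = M.chain k n := by
  induction n with
  | zero => simp
  | succ n ih => rw [pow_succ', ← Matrix.mulVec_mulVec, ih, mulVec_chain]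

/-- Nilpotency truncates the exponential series: up to a scalar, the orbit of a kick direction is a
polynomial in t whose coefficients are nonzero multiples of all unit vectors of the block. -/
theorem exp_mulVec_chain (k : Fin 2) (t : ℝ) :
    Real.exp (t * M.ν k) • (NormedSpace.exp (t • M.A)).mulVec (M.chain k 0) =
      ∑ i ∈ Finset.range (M.η k + 1), (t ^ i / (i.factorial : ℝ)) • M.chain k i := by
  rw [← Matrix.smul_mulVec, ← Matrix.exp_smul_add_smul_one]
  have h := Matrix.hasSum_exp_smul_mulVec (M.A + M.ν k • (1 : Matrix M.Idx M.Idx ℝ)) t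
    (M.chain k 0)
  simp only [pow_mulVec_chain] at h
  refine h.unique (hasSum_sum_of_ne_finset_zero fun i hi => ?_)
  rw [Finset.mem_range] at hi
  rw [chain, if_neg (by omega), smul_zero]

theorem kick_single (k : Fin 2) : M.kick (Pi.single (k + 1) 1) = M.chain k 0 := by
  have e : (Fin.ofNat (M.η k + 1) (M.η k - 0) : Fin (M.η k + 1)) = Fin.last _ :=
    Fin.ext (by simp)
  rw [chain, if_pos (Nat.zero_le _), e]
  ext ⟨k', j⟩
  rw [kick_apply]
  by_cases hk : k' = k
  · subst hk
    by_cases hj : j = Fin.last _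
    · subst hj; simp
    · rw [if_neg hj, Pi.single_eq_of_ne]
      exact fun h => hj (eq_of_heq (Sigma.mk.inj h).2)
  · rw [Pi.single_eq_of_ne fun h => hk (Sigma.mk.inj h).1, Pi.single_eq_of_ne, ite_self]
    exact fun h => hk (add_right_cancel h)

/-- A functional that vanishes along the noise orbits of the linear flow is zero. -/
theorem functional_eq_zero {Δ : ℝ} (hΔ : 0 < Δ) (φ : M.State →ₗ[ℝ] ℝ)
    (h : ∀ (j : ℕ) u, φ ((M.linFlow Δ ^ (j + 1)) (M.kick u)) = 0) : φ = 0 := by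
  have hc : ∀ k i, φ (M.chain k i) = 0 := fun k i => by
    by_cases hi : i < M.η k + 1
    swap
    · rw [chain, if_neg (by omega), map_zero]
    -- This polynomial is φ along the rescaled orbit. It vanishes at the infinitely many times (j +
    -- 1)Δ, hence identically, and its coefficients are φ on the unit vectors up to factorials.
    set p : Polynomial ℝ := ∑ i ∈ Finset.range (M.η k + 1),
      Polynomial.monomial i (φ (M.chain k i) / (i.factorial : ℝ)) with hp
    have heval : ∀ t, p.eval t =
        φ (Real.exp (t * M.ν k) • (NormedSpace.exp (t • M.A)).mulVec (M.chain k 0)) := fun t => by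
      rw [exp_mulVec_chain, map_sum, hp, Polynomial.eval_finsetSum]
      refine Finset.sum_congr rfl fun i _ => ?_
      rw [Polynomial.eval_monomial, map_smul, smul_eq_mul]
      ring
    have hroot : ∀ j : ℕ, p.eval (((j + 1 : ℕ) : ℝ) * Δ) = 0 := fun j => by
      rw [heval, map_smul, ← linFlow_pow, ← kick_single, h, smul_zero]
    have hp0 : p = 0 := by
      refine Polynomial.eq_zero_of_infinite_isRoot p
        ((Set.infinite_range_of_injective (f := fun j : ℕ => ((j + 1 : ℕ) : ℝ) * Δ) ?_).mono ?_)
      · intro a b hab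
        have := mul_right_cancel₀ hΔ.ne' hab
        have := Nat.cast_injective this
        omega
      · rintro _ ⟨j, rfl⟩
        exact hroot j
    have hcoeff : p.coeff i = φ (M.chain k i) / (i.factorial : ℝ) := by
      rw [hp, Polynomial.finsetSum_coeff]
      simp only [Polynomial.coeff_monomial]
      rw [Finset.sum_ite_eq' (Finset.range (M.η k + 1)) i, if_pos (Finset.mem_range.2 hi)]
    rw [hp0, Polynomial.coeff_zero] at hcoeff
    have hf : (i.factorial : ℝ) ≠ 0 := Nat.cast_ne_zero.2 i.factorial_ne_zero
    exact (div_eq_zero_iff.1 hcoeff.symm).resolve_right hf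
  refine LinearMap.pi_ext' fun ⟨k, j⟩ => LinearMap.ext_ring ?_
  have := hc k (M.η k - j)
  have e : (Fin.ofNat (M.η k + 1) (M.η k - (M.η k - j)) : Fin (M.η k + 1)) = j := by
    have := j.2
    ext
    rw [Fin.val_ofNat, Nat.mod_eq_of_lt (by omega)]
    omega
  rw [chain, if_pos (Nat.sub_le _ _), e] at this
  simpa using! this

/-- Controllability: after sufficiently many steps every state can be reached linearly. -/
theorem exists_steer_rightInverse {Δ : ℝ} (hΔ : 0 < Δ) :
    ∃ n : ℕ, n ≠ 0 ∧ ∃ S : M.State →ₗ[ℝ] (ℕ → Fin 2 → ℝ), ∀ x, M.steer Δ n (S x) = x := by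
  have hmono : Monotone fun n => LinearMap.range (M.steer Δ n) :=
    monotone_nat_of_le_succ fun n => by
      rintro _ ⟨w, rfl⟩
      exact ⟨_, M.steer_succ_shift Δ n w⟩
  -- Once the reachable subspaces stop growing, the stable one is closed under a further controlled
  -- step, so it contains the whole orbit of every kick; a functional vanishing on it must be zero.
  obtain ⟨N, hN⟩ := monotone_stabilizes_iff_noetherian.2
    (inferInstance : IsNoetherian ℝ M.State) ⟨_, hmono⟩
  have hN1 : LinearMap.range (M.steer Δ N) = LinearMap.range (M.steer Δ (N + 1)) :=
    hN (N + 1) (by omega)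
  have hstep : ∀ y ∈ LinearMap.range (M.steer Δ N), ∀ u,
      M.linFlow Δ (y + M.kick u) ∈ LinearMap.range (M.steer Δ N) := by
    rintro _ ⟨w, rfl⟩ u
    rw [hN1]
    refine ⟨Function.update w N u, ?_⟩
    rw [steer_succ, Function.update_self, M.steer_congr Δ fun i hi =>
      Function.update_of_ne hi.ne u w]
  have horbit : ∀ (j : ℕ) u,
      (M.linFlow Δ ^ (j + 1)) (M.kick u) ∈ LinearMap.range (M.steer Δ N) := fun j u => by
    induction j with
    | zero => simpa using hstep 0 (zero_mem _) u
    | succ j ih => simpa [pow_succ' _ (j + 1)] using hstep _ ih 0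
  have htop : LinearMap.range (M.steer Δ N) = ⊤ := by
    by_contra hne
    obtain ⟨φ, hφ0, hφ⟩ := Submodule.exists_le_ker_of_lt_top _ (lt_top_iff_ne_top.2 hne)
    exact hφ0 (M.functional_eq_zero hΔ φ fun j u => hφ (horbit j u))
  rw [hN1] at htop
  obtain ⟨S, hS⟩ := LinearMap.exists_rightInverse_of_surjective _ htop
  -- The index N + 1 has the same range as N and is certainly nonzero.
  exact ⟨N + 1, by omega, S, fun x => LinearMap.congr_fun hS x⟩

end HawkesModel

end

/-! ### One step of the scheme and the drift condition. -/

noncomputable section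

open Filter Topology

namespace HawkesModel

variable (M : HawkesModel)

/-- Conditional mean of the increment driven by population `l`. -/
def incrMean (Δ : ℝ) (x : M.State) (l : Fin 2) : ℝ :=
  Δ * (M.c (l + 1) * M.f l (x ⟨l, 0⟩))

/-- Conditional (signed) standard deviation of the increment driven by population `l`. -/
def incrDev (Δ : ℝ) (x : M.State) (l : Fin 2) : ℝ :=
  √Δ / √(M.N : ℝ) * (M.c (l + 1) / √(M.p l) * √(M.f l (x ⟨l, 0⟩)))

/-- The nonlinearity affects only the mean and deviation of the kick, not its directions. A step is
thus a step of the linear control system with a random control whose components are independent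
Gaussians given x. -/
theorem step_eq (Δ : ℝ) (x : M.State) (ξ : Fin 2 → ℝ) :
    M.step Δ x ξ =
      M.linFlow Δ (x + M.kick fun l => M.incrMean Δ x l + M.incrDev Δ x l * ξ l) := by
  rw [step, linFlow_apply]
  congr 1
  ext ⟨k, j⟩
  have hk : k + 1 + 1 = k := by fin_cases k <;> rfl
  simp only [flow₂, Pi.add_apply, Pi.smul_apply, smul_eq_mul, kick_apply, B, Matrix.mulVec,
    dotProduct, σ, Matrix.of_apply]
  by_cases hj : j = Fin.last (M.η k)
  · simp only [hj, true_and, if_true, ite_mul, zero_mul]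
    rw [Finset.sum_ite_eq' Finset.univ (k + 1), if_pos (Finset.mem_univ _)]
    simp only [incrMean, incrDev, hk]
    ring
  · simp [hj]

theorem isMarkovKernel_transition (hA : M.AssumptionA) (Δ : ℝ) :
    IsMarkovKernel (M.transition Δ) :=
  Kernel.IsMarkovKernel.map _ (M.measurable_step hA Δ)

theorem abs_c (k : Fin 2) : |M.c k| = 1 := by
  rcases M.c_sign k with h | h <;> simp [h]

theorem exists_incr_bound (hA : M.AssumptionA) {Δ : ℝ} (hΔ : 0 < Δ) :
    ∃ b : ℝ, 0 ≤ b ∧ ∀ x l, |M.incrMean Δ x l| ≤ b ∧ |M.incrDev Δ x l| ≤ b := by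
  have key : ∀ l, ∃ b : ℝ, 0 ≤ b ∧ ∀ x, |M.incrMean Δ x l| ≤ b ∧ |M.incrDev Δ x l| ≤ b :=
    fun l => by
    obtain ⟨F, hF⟩ := hA.bounded l
    have hF0 : 0 ≤ F := (hA.pos l 0).le.trans (hF 0)
    refine ⟨Δ * F + √Δ / √(M.N : ℝ) * (1 / √(M.p l) * √F), by positivity, fun x => ⟨?_, ?_⟩⟩
    · rw [incrMean, abs_mul, abs_mul, abs_c, one_mul, abs_of_pos hΔ, abs_of_pos (hA.pos l _)]
      have : 0 ≤ √Δ / √(M.N : ℝ) * (1 / √(M.p l) * √F) := by positivity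
      have := mul_le_mul_of_nonneg_left (hF (x ⟨l, 0⟩)) hΔ.le
      linarith
    · rw [incrDev, abs_mul, abs_mul, abs_of_nonneg (by positivity : 0 ≤ √Δ / √(M.N : ℝ)), abs_div,
        abs_c, abs_of_nonneg (Real.sqrt_nonneg (M.p l)), abs_of_nonneg (Real.sqrt_nonneg (M.f l _))]
      have h1 : √Δ / √(M.N : ℝ) * (1 / √(M.p l) * √(M.f l (x ⟨l, 0⟩))) ≤
          √Δ / √(M.N : ℝ) * (1 / √(M.p l) * √F) := by
        gcongr
        exact hF _
      have : 0 ≤ Δ * F := by positivity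
      linarith
  choose b hb0 hb using key
  refine ⟨b 0 + b 1, add_nonneg (hb0 0) (hb0 1), fun x l => ?_⟩
  have : b l ≤ b 0 + b 1 := by
    fin_cases l
    · exact le_add_of_nonneg_right (hb0 1)
    · exact le_add_of_nonneg_left (hb0 0)
  exact ⟨(hb l x).1.trans this, (hb l x).2.trans this⟩

theorem exists_lyapunov_kick_le :
    ∃ W : ℝ, 0 ≤ W ∧ ∀ u, M.lyapunov (M.kick u) ≤ W * (|u 0| + |u 1|) := by
  refine ⟨∑ i, M.weight i, Finset.sum_nonneg fun i _ => (M.weight_pos i).le, fun u => ?_⟩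
  rw [lyapunov_eq_sum, Finset.sum_mul]
  refine Finset.sum_le_sum fun i _ => mul_le_mul_of_nonneg_left ?_ (M.weight_pos i).le
  have h : ∀ l, |u l| ≤ |u 0| + |u 1| := fun l => by
    fin_cases l
    · exact le_add_of_nonneg_right (abs_nonneg _)
    · exact le_add_of_nonneg_left (abs_nonneg _)
  rw [kick_apply]
  split_ifs
  · exact h _
  · rw [abs_zero]; positivity

theorem exists_lyapunov_step_le (hA : M.AssumptionA) {Δ : ℝ} (hΔ : 0 < Δ) :
    ∃ θ D : ℝ, 0 < θ ∧ θ < 1 ∧ 0 ≤ D ∧ ∀ x ξ, 1 + M.lyapunov (M.step Δ x ξ) ≤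
      θ * (1 + M.lyapunov x) + D * (1 + |ξ 0| + |ξ 1|) := by
  obtain ⟨θ, hθ0, hθ1, hθ⟩ := M.exists_lyapunov_flow₁_le hΔ
  obtain ⟨b, hb0, hb⟩ := M.exists_incr_bound hA hΔ
  obtain ⟨W, hW0, hW⟩ := M.exists_lyapunov_kick_le
  -- The summand 1 absorbs the defect 1 - θ from writing θ(1 + G) in place of 1 + θG.
  refine ⟨θ, 1 + W * (2 * b), hθ0, hθ1, by positivity, fun x ξ => ?_⟩
  set u : Fin 2 → ℝ := fun l => M.incrMean Δ x l + M.incrDev Δ x l * ξ l with hu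
  have hul : ∀ l, |u l| ≤ b + b * |ξ l| := fun l => by
    refine (abs_add_le _ _).trans (add_le_add (hb x l).1 ?_)
    rw [abs_mul]
    exact mul_le_mul_of_nonneg_right (hb x l).2 (abs_nonneg _)
  have h1 : M.lyapunov (M.step Δ x ξ) ≤ θ * (M.lyapunov x + M.lyapunov (M.kick u)) := by
    rw [step_eq, linFlow_apply]
    exact (hθ _).trans (mul_le_mul_of_nonneg_left (M.lyapunov_add_le _ _) hθ0.le)
  have h2 : M.lyapunov (M.kick u) ≤ W * (2 * b) * (1 + |ξ 0| + |ξ 1|) := by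
    refine (hW u).trans ?_
    rw [mul_assoc]
    refine mul_le_mul_of_nonneg_left ?_ hW0
    have := hul 0
    have := hul 1
    have := mul_nonneg hb0 (abs_nonneg (ξ 0))
    have := mul_nonneg hb0 (abs_nonneg (ξ 1))
    linarith
  have h3 := M.lyapunov_nonneg (M.kick u)
  have h4 := mul_le_of_le_one_left h3 hθ1.le
  have := abs_nonneg (ξ 0)
  have := abs_nonneg (ξ 1)
  nlinarith

theorem memLp_eval_stdNormal (m : NNReal) (l : Fin 2) :
    MemLp (fun ξ : Fin 2 → ℝ => ξ l) m stdNormal :=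
  (memLp_id_gaussianReal (μ := 0) (v := 1) m).comp_measurePreserving
    (measurePreserving_eval (fun _ : Fin 2 => gaussianReal 0 1) l)

theorem integrable_rpow_stdNormal {m : ℝ} (hm : 1 ≤ m) {D : ℝ} (hD : 0 ≤ D) :
    Integrable (fun ξ : Fin 2 → ℝ => (D * (1 + |ξ 0| + |ξ 1|)) ^ m) stdNormal := by
  have hm0 : 0 ≤ m := zero_le_one.trans hm
  have h0 : ∀ l, MemLp (fun ξ : Fin 2 → ℝ => |ξ l|) (m.toNNReal : ENNReal) stdNormal :=
    fun l => (memLp_eval_stdNormal m.toNNReal l).abs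
  have h1 : MemLp (fun _ : Fin 2 → ℝ => (1 : ℝ)) (m.toNNReal : ENNReal) stdNormal :=
    memLp_const 1
  have h : MemLp (fun ξ : Fin 2 → ℝ => D * (1 + |ξ 0| + |ξ 1|)) (m.toNNReal : ENNReal)
      stdNormal := ((h1.add (h0 0)).add (h0 1)).const_mul D
  have h2 := h.integrable_norm_rpow (by simpa using lt_of_lt_of_le zero_lt_one hm)
    ENNReal.coe_ne_top
  refine h2.congr (ae_of_all _ fun ξ => ?_)
  have e : 0 ≤ D * (1 + |ξ 0| + |ξ 1|) := by positivity
  rw [ENNReal.coe_toReal, Real.coe_toNNReal _ hm0]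
  exact congrArg (· ^ m) (abs_of_nonneg e)

/-- Convexity with weights θ and 1 - θ at the points u and z/(1 - θ). The coefficient of u ^ m
remains θ, so the same drift rate serves every m. -/
theorem rpow_add_le_convex {m : ℝ} (hm : 1 ≤ m) {θ u z : ℝ} (hθ0 : 0 < θ) (hθ1 : θ < 1)
    (hu : 0 ≤ u) (hz : 0 ≤ z) :
    (θ * u + z) ^ m ≤ θ * u ^ m + (1 - θ) * (z / (1 - θ)) ^ m := by
  have h1 : 0 < 1 - θ := sub_pos.2 hθ1
  have := (convexOn_rpow hm).2 (x := u) (y := z / (1 - θ)) hu (div_nonneg hz h1.le) hθ0.le h1.le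
    (by ring)
  simp only [smul_eq_mul] at this
  rwa [mul_div_cancel₀ _ h1.ne'] at this

/-- The drift condition for all powers `(1 + G)^m` of the Lyapunov function. -/
theorem exists_driftCondition (hA : M.AssumptionA) {Δ : ℝ} (hΔ : 0 < Δ) {m : ℝ} (hm : 1 ≤ m) :
    ∃ γ K : ℝ, Kernel.DriftCondition (M.transition Δ) (fun x => (1 + M.lyapunov x) ^ m) γ K := by
  obtain ⟨θ, D, hθ0, hθ1, hD, hstep⟩ := M.exists_lyapunov_step_le hA hΔ
  have h1 : 0 < 1 - θ := sub_pos.2 hθ1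
  have hm0 : 0 ≤ m := zero_le_one.trans hm
  set Z : (Fin 2 → ℝ) → ℝ := fun ξ => (1 - θ) * (D / (1 - θ) * (1 + |ξ 0| + |ξ 1|)) ^ m with hZ
  have hZi : Integrable Z stdNormal :=
    (integrable_rpow_stdNormal hm (div_nonneg hD h1.le)).const_mul _
  have hG0 := M.lyapunov_nonneg
  have hV : Measurable fun x => (1 + M.lyapunov x) ^ m :=
    (M.measurable_lyapunov.const_add 1).pow_const m
  have hV0 : ∀ x, 0 ≤ (1 + M.lyapunov x) ^ m := fun x => by have := hG0 x; positivity
  have hle : ∀ x ξ, (1 + M.lyapunov (M.step Δ x ξ)) ^ m ≤ θ * (1 + M.lyapunov x) ^ m + Z ξ :=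
    fun x ξ => by
    refine (Real.rpow_le_rpow (by have := hG0 (M.step Δ x ξ); positivity) (hstep x ξ) hm0).trans ?_
    have := hG0 x
    refine (rpow_add_le_convex hm hθ0 hθ1 (by positivity) (by positivity)).trans_eq ?_
    rw [hZ, mul_div_right_comm]
  have hms : ∀ x, Measurable (M.step Δ x) := fun x =>
    (M.measurable_step hA Δ).comp measurable_prodMk_left
  have hbi : ∀ x, Integrable (fun ξ => θ * (1 + M.lyapunov x) ^ m + Z ξ) stdNormal := fun x =>
    (integrable_const _).add hZi
  have hi : ∀ x, Integrable (fun ξ => (1 + M.lyapunov (M.step Δ x ξ)) ^ m) stdNormal := fun x =>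
    (hbi x).mono' (hV.comp (hms x)).aestronglyMeasurable (ae_of_all _ fun ξ => by
      rw [Real.norm_eq_abs, abs_of_nonneg (hV0 _)]; exact hle x ξ)
  refine ⟨θ, ∫ ξ, Z ξ ∂stdNormal, hV, fun x => Real.one_le_rpow (by linarith [hG0 x]) hm0,
    hθ0.le, hθ1, integral_nonneg fun ξ => ?_, fun x => ?_, fun x => ?_⟩
  · simp only [hZ, Pi.zero_apply]; positivity
  · rw [transition_apply M hA, integrable_map_measure hV.aestronglyMeasurable (hms x).aemeasurable]
    exact hi x
  · rw [transition_apply M hA, integral_map (hms x).aemeasurable hV.aestronglyMeasurable]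
    refine (integral_mono (hi x) (hbi x) (hle x)).trans_eq ?_
    rw [integral_add (integrable_const _) hZi]
    simp

end HawkesModel

end

/-! ### Gaussian lower bounds and minorization. -/

noncomputable section

open Filter Topology

section LowerBounds

/-- The product measure comes from the largest outer measure bounded by the products on boxes, so
domination need only be checked on boxes. -/
theorem MeasureTheory.Measure.prod_smul_pi_le {ι : Type*} [Fintype ι] {X : ι → Type*}
    [∀ i, MeasurableSpace (X i)] {μ ν : ∀ i, Measure (X i)} [∀ i, SigmaFinite (μ i)]
    [∀ i, SigmaFinite (ν i)] {c : ι → ENNReal} (h : ∀ i, c i • ν i ≤ μ i) :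
    (∏ i, c i) • Measure.pi ν ≤ Measure.pi μ := by
  have h1 : ((∏ i, c i) • Measure.pi ν).toOuterMeasure ≤
      OuterMeasure.pi fun i => (μ i).toOuterMeasure := by
    rw [OuterMeasure.le_pi]
    intro s _
    change ((∏ i, c i) • Measure.pi ν) (Set.univ.pi s) ≤ ∏ i, μ i (s i)
    rw [Measure.smul_apply, Measure.pi_pi, smul_eq_mul, ← Finset.prod_mul_distrib]
    exact Finset.prod_le_prod' fun i _ => h i (s i)
  rw [Measure.le_iff]
  intro s hs
  refine (h1 s).trans_eq ?_
  rw [Measure.pi, toMeasure_apply _ _ hs]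

/-- Gaussian laws with bounded means and standard deviations bounded away from zero dominate a
multiple of Lebesgue measure on bounded intervals of length one. -/
theorem ProbabilityTheory.exists_smul_map_le_map_gaussianReal (R : ℝ) {s₀ : ℝ} (hs₀ : 0 < s₀) :
    ∃ ε : ℝ, 0 < ε ∧ ∀ a s w : ℝ, |a| ≤ R → s₀ ≤ |s| → |s| ≤ R → |w| ≤ R →
      ENNReal.ofReal ε • (volume.restrict (Set.Icc (0 : ℝ) 1)).map (w + ·) ≤
        (gaussianReal 0 1).map (fun ξ => a + s * ξ) := by
  -- A lower bound for the density: the variance lies between s₀² and R², and |y - a| ≤ 2R + 1 for y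
  -- in [w, w + 1]. The added 1 keeps the square root positive for every R.
  set ε := (√(2 * Real.pi * (R ^ 2 + 1)))⁻¹ * Real.exp (-(2 * |R| + 1) ^ 2 / (2 * s₀ ^ 2)) with hε
  refine ⟨ε, by positivity, fun a s w ha hs hsR hw => ?_⟩
  have hs0 : s ≠ 0 := abs_pos.1 (hs₀.trans_le hs)
  have hR : 0 ≤ R := (abs_nonneg a).trans ha
  rw [abs_of_nonneg hR] at hε
  set v : NNReal := .mk (s ^ 2) (sq_nonneg s) with hv
  have hv0 : v ≠ 0 := fun h => hs0 (by simpa [hv] using congrArg NNReal.toReal h)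
  have hvc : (v : ℝ) = s ^ 2 := rfl
  have hlaw : (gaussianReal 0 1).map (fun ξ => a + s * ξ) = gaussianReal a v := by
    have : (fun ξ => a + s * ξ) = (a + ·) ∘ (s * ·) := rfl
    rw [this, ← Measure.map_map (by fun_prop) (by fun_prop), gaussianReal_map_const_mul,
      gaussianReal_map_const_add, mul_zero, zero_add, mul_one]
  have hshift : (volume.restrict (Set.Icc (0 : ℝ) 1)).map (w + ·) =
      volume.restrict (Set.Icc w (w + 1)) := by
    have h := (measurePreserving_add_left (volume : Measure ℝ) w).restrict_preimage
      (measurableSet_Icc (a := w) (b := w + 1))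
    rw [Set.preimage_const_add_Icc, sub_self, add_sub_cancel_left] at h
    exact h.map_eq
  rw [hlaw, hshift, gaussianReal_of_var_ne_zero _ hv0, Measure.le_iff]
  intro t ht
  rw [Measure.smul_apply, Measure.restrict_apply ht, withDensity_apply _ ht, smul_eq_mul,
    ← setLIntegral_const]
  refine (setLIntegral_mono (measurable_gaussianPDF a v) fun y hy => ?_).trans
    (lintegral_mono_set Set.inter_subset_left)
  refine ENNReal.ofReal_le_ofReal ?_
  rw [gaussianPDFReal, hvc, hε]
  have hs2 : s₀ ^ 2 ≤ s ^ 2 := by rw [← sq_abs s]; gcongr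
  have hs2' : s ^ 2 ≤ R ^ 2 := by rw [← sq_abs s]; gcongr
  have hspos : 0 < s ^ 2 := by positivity
  have hy2 : (y - a) ^ 2 ≤ (2 * R + 1) ^ 2 := by
    obtain ⟨-, hy1, hy2⟩ := hy
    rw [abs_le] at ha hw
    apply sq_le_sq'
    · linarith
    · linarith
  gcongr ?_ * Real.exp ?_
  · gcongr
    linarith
  · rw [neg_div, neg_div, neg_le_neg_iff]
    gcongr

end LowerBounds

namespace HawkesModel

variable (M : HawkesModel)

/-- The uniform law on the unit square. -/
def unitSquare : Measure (Fin 2 → ℝ) := Measure.pi fun _ => volume.restrict (Set.Icc (0 : ℝ) 1)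

instance : IsProbabilityMeasure unitSquare := by
  have : IsProbabilityMeasure (volume.restrict (Set.Icc (0 : ℝ) 1)) := ⟨by simp⟩
  unfold unitSquare
  infer_instance

theorem ae_unitSquare : ∀ᵐ v ∂unitSquare, ∀ l, |v l| ≤ 1 := by
  rw [ae_all_iff]
  intro l
  have h : ∀ᵐ t ∂(volume.restrict (Set.Icc (0 : ℝ) 1)), |t| ≤ 1 := by
    refine (ae_restrict_mem measurableSet_Icc).mono fun t ht => ?_
    rw [abs_of_nonneg ht.1]
    exact ht.2
  have : IsProbabilityMeasure (volume.restrict (Set.Icc (0 : ℝ) 1)) := ⟨by simp⟩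
  exact (measurePreserving_eval (fun _ : Fin 2 => volume.restrict (Set.Icc (0 : ℝ) 1)) l
    ).quasiMeasurePreserving.ae h

theorem measurable_linFlow (Δ : ℝ) : Measurable (M.linFlow Δ) :=
  (LinearMap.continuous_of_finiteDimensional _).measurable

theorem measurable_kick : Measurable M.kick :=
  (LinearMap.continuous_of_finiteDimensional _).measurable

/-- The law of the linear system started at `0` and driven by independent uniform vectors. -/
def noiseLaw (Δ : ℝ) : ℕ → Measure M.State
  | 0 => Measure.dirac 0
  | n + 1 => ((noiseLaw Δ n).prod unitSquare).map fun p => M.linFlow Δ (p.1 + M.kick p.2)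

theorem measurable_noiseStep (Δ : ℝ) :
    Measurable fun p : M.State × (Fin 2 → ℝ) => M.linFlow Δ (p.1 + M.kick p.2) :=
  (M.measurable_linFlow Δ).comp (measurable_fst.add (M.measurable_kick.comp measurable_snd))

instance isProbabilityMeasure_noiseLaw (Δ : ℝ) (n : ℕ) :
    IsProbabilityMeasure (M.noiseLaw Δ n) := by
  induction n with
  | zero => unfold noiseLaw; infer_instance
  | succ n ih =>
    exact Measure.isProbabilityMeasure_map (M.measurable_noiseStep Δ).aemeasurable

theorem lyapunov_linFlow_le {Δ : ℝ} (hΔ : 0 < Δ) (x : M.State) :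
    M.lyapunov (M.linFlow Δ x) ≤ M.lyapunov x := by
  obtain ⟨θ, -, hθ1, hθ⟩ := M.exists_lyapunov_flow₁_le hΔ
  exact (hθ x).trans (mul_le_of_le_one_left (M.lyapunov_nonneg x) hθ1.le)

/-- The driving vectors are bounded and the flow does not increase the norm. This confines the
accumulated noise to a region where the one-step lower bound is uniform. -/
theorem exists_ae_noiseLaw_lyapunov_le {Δ : ℝ} (hΔ : 0 < Δ) (n : ℕ) :
    ∃ r : ℝ, ∀ᵐ z ∂M.noiseLaw Δ n, M.lyapunov z ≤ r := by
  induction n with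
  | zero =>
    refine ⟨M.lyapunov 0, ?_⟩
    rw [noiseLaw, ae_dirac_iff (measurableSet_le M.measurable_lyapunov measurable_const)]
  | succ n ih =>
    obtain ⟨r, hr⟩ := ih
    obtain ⟨W, hW0, hW⟩ := M.exists_lyapunov_kick_le
    refine ⟨r + W * 2, ?_⟩
    rw [noiseLaw, ae_map_iff (M.measurable_noiseStep Δ).aemeasurable
      (measurableSet_le M.measurable_lyapunov measurable_const)]
    filter_upwards [Measure.quasiMeasurePreserving_fst.ae hr,
      Measure.quasiMeasurePreserving_snd.ae ae_unitSquare] with p hp1 hp2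
    refine (M.lyapunov_linFlow_le hΔ _).trans ((M.lyapunov_add_le _ _).trans
      (add_le_add hp1 ((hW _).trans (mul_le_mul_of_nonneg_left ?_ hW0))))
    linarith [hp2 0, hp2 1]

/-- One-step lower bound for the transition kernel, uniform over bounded states and controls. -/
theorem exists_step_lower_bound (hA : M.AssumptionA) {Δ : ℝ} (hΔ : 0 < Δ) (R : ℝ) :
    ∃ ε : ℝ, 0 < ε ∧ ∀ y, M.lyapunov y ≤ R → ∀ w : Fin 2 → ℝ, (∀ l, |w l| ≤ R) →
      ENNReal.ofReal ε • unitSquare.map (fun v => M.linFlow Δ (y + M.kick (w + v))) ≤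
        M.transition Δ y := by
  obtain ⟨b, hb0, hb⟩ := M.exists_incr_bound hA hΔ
  have hN : (0 : ℝ) < M.N := Nat.cast_pos.2 M.N_pos
  -- The first coordinate of each block has weight 1, so it is at least -R on the sublevel set;
  -- monotonicity and positivity of f then bound the deviation away from zero.
  set s₀ : Fin 2 → ℝ := fun l => √Δ / √(M.N : ℝ) * (1 / √(M.p l) * √(M.f l (-R))) with hs₀
  have hs₀0 : ∀ l, 0 < s₀ l := fun l => by
    have := M.p_pos l
    have := hA.pos l (-R)
    simp only [hs₀]
    positivity
  choose ε hε0 hε using fun l => exists_smul_map_le_map_gaussianReal (max b R) (hs₀0 l)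
  refine ⟨∏ l, ε l, Finset.prod_pos fun l _ => hε0 l, fun y hy w hw => ?_⟩
  have hdev : ∀ l, s₀ l ≤ |M.incrDev Δ y l| := fun l => by
    rw [incrDev, abs_mul, abs_mul, abs_of_nonneg (by positivity : 0 ≤ √Δ / √(M.N : ℝ)), abs_div,
      abs_c, abs_of_nonneg (Real.sqrt_nonneg (M.p l)), abs_of_nonneg (Real.sqrt_nonneg (M.f l _))]
    have h1 := (M.weight_mul_abs_le_lyapunov y ⟨l, 0⟩).trans hy
    have h2 : -R ≤ y ⟨l, 0⟩ := by
      simp only [weight, Fin.val_zero, pow_zero, div_one, Nat.cast_zero, zero_add, one_mul] at h1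
      exact (abs_le.1 h1).1
    have h3 := hA.mono l h2
    simp only [hs₀]
    gcongr
  have h1 : (∏ l, ENNReal.ofReal (ε l)) • unitSquare.map (fun v l => w l + v l) ≤
      stdNormal.map (fun ξ l => M.incrMean Δ y l + M.incrDev Δ y l * ξ l) := by
    have : ∀ l : Fin 2, IsProbabilityMeasure
        ((volume.restrict (Set.Icc (0 : ℝ) 1)).map (w l + ·)) := fun l => by
      have : IsProbabilityMeasure (volume.restrict (Set.Icc (0 : ℝ) 1)) := ⟨by simp⟩
      exact Measure.isProbabilityMeasure_map (by fun_prop)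
    have : ∀ l : Fin 2, IsProbabilityMeasure
        ((gaussianReal 0 1).map (fun ξ => M.incrMean Δ y l + M.incrDev Δ y l * ξ)) := fun l =>
      Measure.isProbabilityMeasure_map (by fun_prop)
    rw [unitSquare, stdNormal, Measure.pi_map_pi (fun l => by fun_prop),
      Measure.pi_map_pi (f := fun l ξ => M.incrMean Δ y l + M.incrDev Δ y l * ξ)
        (fun l => by fun_prop)]
    exact Measure.prod_smul_pi_le fun l => hε l _ _ _ ((hb y l).1.trans (le_max_left _ _))
      (hdev l) ((hb y l).2.trans (le_max_left _ _)) ((hw l).trans (le_max_right _ _))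
  have hF : Measurable fun u => M.linFlow Δ (y + M.kick u) :=
    (M.measurable_linFlow Δ).comp (M.measurable_kick.const_add y)
  have h2 := Measure.map_mono h1 hF
  rw [Measure.map_smul, Measure.map_map hF (by fun_prop), Measure.map_map hF (by fun_prop)] at h2
  rw [transition_apply M hA, ENNReal.ofReal_prod_of_nonneg fun l _ => (hε0 l).le]
  have e : M.step Δ y = (fun u => M.linFlow Δ (y + M.kick u)) ∘
      (fun ξ l => M.incrMean Δ y l + M.incrDev Δ y l * ξ l) := by
    ext1 ξ; exact M.step_eq Δ y ξ
  rw [e]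
  exact h2

theorem exists_lyapunov_steer_le {Δ : ℝ} (hΔ : 0 < Δ) (R : ℝ) (n : ℕ) :
    ∃ r : ℝ, ∀ x, M.lyapunov x ≤ R → ∀ w : ℕ → Fin 2 → ℝ, (∀ i < n, ∀ l, |w i l| ≤ R) →
      M.lyapunov ((M.linFlow Δ ^ n) x + M.steer Δ n w) ≤ r := by
  obtain ⟨W, hW0, hW⟩ := M.exists_lyapunov_kick_le
  induction n with
  | zero => exact ⟨R, fun x hx w _ => by simpa [steer_zero] using hx⟩
  | succ n ih =>
    obtain ⟨r, hr⟩ := ih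
    refine ⟨r + W * (2 * R), fun x hx w hw => ?_⟩
    have h1 := hr x hx w fun i hi => hw i (by omega)
    rw [pow_succ', Module.End.mul_apply, steer_succ, ← map_add, ← add_assoc]
    refine (M.lyapunov_linFlow_le hΔ _).trans ((M.lyapunov_add_le _ _).trans
      (add_le_add h1 ((hW _).trans (mul_le_mul_of_nonneg_left ?_ hW0))))
    linarith [hw n (by omega) 0, hw n (by omega) 1]

/-- Iterated lower bound: the `n`-step kernel dominates a multiple of the noise law translated to
any state reachable with bounded controls. -/
theorem exists_pow_lower_bound (hA : M.AssumptionA) {Δ : ℝ} (hΔ : 0 < Δ) (R : ℝ) (n : ℕ) :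
    ∃ ε : ℝ, 0 < ε ∧ ∀ x, M.lyapunov x ≤ R → ∀ w : ℕ → Fin 2 → ℝ,
      (∀ i < n, ∀ l, |w i l| ≤ R) →
      ENNReal.ofReal ε • (M.noiseLaw Δ n).map
        (fun z => z + ((M.linFlow Δ ^ n) x + M.steer Δ n w)) ≤ (M.transition Δ ^ n) x := by
  have := M.isMarkovKernel_transition hA Δ
  induction n with
  | zero =>
    refine ⟨1, one_pos, fun x _ w _ => ?_⟩
    rw [Kernel.pow_zero_apply, noiseLaw, Measure.map_dirac' (measurable_add_const _)]
    simp [steer_zero]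
  | succ n ih =>
    obtain ⟨ε, hε0, hε⟩ := ih
    obtain ⟨r₁, hr₁⟩ := M.exists_lyapunov_steer_le hΔ R n
    obtain ⟨r₂, hr₂⟩ := M.exists_ae_noiseLaw_lyapunov_le hΔ n
    -- Before the last step the state is z + q, with z from the noise law (at most r₂) and q the
    -- steered state (at most r₁).
    obtain ⟨δ, hδ0, hδ⟩ := M.exists_step_lower_bound hA hΔ (max R (r₂ + r₁))
    refine ⟨ε * δ, mul_pos hε0 hδ0, fun x hx w hw => ?_⟩
    have hw' : ∀ i < n, ∀ l, |w i l| ≤ R := fun i hi => hw i (by omega)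
    set q := (M.linFlow Δ ^ n) x + M.steer Δ n w with hq
    have hq' : (M.linFlow Δ ^ (n + 1)) x + M.steer Δ (n + 1) w =
        M.linFlow Δ (q + M.kick (w n)) := by
      rw [pow_succ', Module.End.mul_apply, steer_succ, ← map_add, ← add_assoc]
    rw [hq', Measure.le_iff]
    intro s hs
    have hmk : Measurable fun y => M.transition Δ y s := (M.transition Δ).measurable_coe hs
    have hn := M.measurable_noiseStep Δ
    -- By linearity the last noise step and the last control merge into one kick w n + v applied at
    -- z + q. The one-step bound is integrated over z, and the induction hypothesis is inserted
    -- through the Chapman–Kolmogorov equation.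
    calc (ENNReal.ofReal (ε * δ) • (M.noiseLaw Δ (n + 1)).map
          (fun z => z + M.linFlow Δ (q + M.kick (w n)))) s
        = ENNReal.ofReal ε * ∫⁻ z, ENNReal.ofReal δ *
            unitSquare.map (fun v => M.linFlow Δ (z + q + M.kick (w n + v))) s
              ∂M.noiseLaw Δ n := by
          have hF : ∀ z, Measurable fun v => M.linFlow Δ (z + q + M.kick (w n + v)) := fun z =>
            (M.measurable_linFlow Δ).comp
              ((M.measurable_kick.comp (measurable_const_add _)).const_add _)
          have hG : Measurable fun p : M.State × (Fin 2 → ℝ) =>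
              M.linFlow Δ (p.1 + M.kick p.2) + M.linFlow Δ (q + M.kick (w n)) := hn.add_const _
          have e : ∀ z, unitSquare.map (fun v => M.linFlow Δ (z + q + M.kick (w n + v))) s =
              unitSquare (Prod.mk z ⁻¹' ((fun p : M.State × (Fin 2 → ℝ) =>
                M.linFlow Δ (p.1 + M.kick p.2) + M.linFlow Δ (q + M.kick (w n))) ⁻¹' s)) :=
            fun z => by
            rw [Measure.map_apply (hF z) hs]
            congr 1
            ext v
            simp only [Set.mem_preimage, ← map_add]
            rw [map_add M.kick, show z + M.kick v + (q + M.kick (w n)) =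
              z + q + (M.kick (w n) + M.kick v) by abel]
          simp only [e]
          rw [lintegral_const_mul _ (measurable_measure_prodMk_left (hG hs)),
            ← Measure.prod_apply (hG hs), Measure.smul_apply, noiseLaw,
            Measure.map_map (by fun_prop) hn, Measure.map_apply (by
              exact hG) hs, smul_eq_mul, ENNReal.ofReal_mul hε0.le, mul_assoc]
          rfl
      _ ≤ ENNReal.ofReal ε * ∫⁻ z, M.transition Δ (z + q) s ∂M.noiseLaw Δ n := by
          refine mul_le_mul_right (lintegral_mono_ae ?_) _
          filter_upwards [hr₂] with z hz
          exact hδ (z + q) (((M.lyapunov_add_le _ _).trans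
            (add_le_add hz (hr₁ x hx w hw'))).trans (le_max_right _ _)) (w n)
            (fun l => (hw n (by omega) l).trans (le_max_left _ _)) s
      _ = ∫⁻ y, M.transition Δ y s
            ∂(ENNReal.ofReal ε • (M.noiseLaw Δ n).map fun z => z + q) := by
          rw [lintegral_smul_measure, lintegral_map hmk (by fun_prop), smul_eq_mul]
      _ ≤ ∫⁻ y, M.transition Δ y s ∂(M.transition Δ ^ n) x :=
          lintegral_mono' (hε x hx w hw') le_rfl
      _ = ((M.transition Δ ^ (n + 1)) x) s := by
          rw [Kernel.pow_succ_apply', Measure.bind_apply hs (Kernel.aemeasurable _)]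

theorem exists_abs_functional_le (φ : M.State →ₗ[ℝ] ℝ) :
    ∃ C : ℝ, 0 ≤ C ∧ ∀ x, |φ x| ≤ C * M.lyapunov x := by
  refine ⟨∑ i, |φ (Pi.single i 1)| / M.weight i,
    Finset.sum_nonneg fun i _ => div_nonneg (abs_nonneg _) (M.weight_pos i).le, fun x => ?_⟩
  rw [LinearMap.pi_apply_eq_sum_univ φ x, Finset.sum_mul]
  refine (Finset.abs_sum_le_sum_abs _ _).trans (Finset.sum_le_sum fun i _ => ?_)
  have e : (fun j => if i = j then (1 : ℝ) else 0) = Pi.single i 1 := by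
    ext j; simp [Pi.single_apply, eq_comm]
  rw [e, smul_eq_mul, abs_mul, div_mul_eq_mul_div, le_div_iff₀ (M.weight_pos i)]
  have := mul_le_mul_of_nonneg_left (M.weight_mul_abs_le_lyapunov x i)
    (abs_nonneg (φ (Pi.single i 1)))
  linarith

/-- Minorization: some power of the kernel dominates, on sublevel sets of the Lyapunov function, a
multiple of a fixed probability measure. -/
theorem exists_minorization (hA : M.AssumptionA) {Δ : ℝ} (hΔ : 0 < Δ) :
    ∃ n : ℕ, n ≠ 0 ∧ ∃ ν : Measure M.State, IsProbabilityMeasure ν ∧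
      ∀ R : ℝ, ∃ α : ℝ, 0 < α ∧ ∀ x, M.lyapunov x ≤ R →
        ENNReal.ofReal α • ν ≤ (M.transition Δ ^ n) x := by
  obtain ⟨n, hn, S, hS⟩ := M.exists_steer_rightInverse hΔ
  refine ⟨n, hn, M.noiseLaw Δ n, inferInstance, fun R => ?_⟩
  -- The control that brings x to the origin in n steps. It cancels the translation of the noise
  -- law, so the minorizing measure does not depend on x.
  let T : M.State →ₗ[ℝ] (ℕ → Fin 2 → ℝ) := -(S ∘ₗ (M.linFlow Δ ^ n))
  have hT : ∀ x, (M.linFlow Δ ^ n) x + M.steer Δ n (T x) = 0 := fun x => by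
    simp [T, hS]
  choose C hC0 hC using fun (i : ℕ) (l : Fin 2) =>
    M.exists_abs_functional_le (LinearMap.proj l ∘ₗ LinearMap.proj i ∘ₗ T)
  -- D R bounds all components of the control, which are linear functionals of x; the summand 1
  -- makes it bound `lyapunov x` as well.
  set D := 1 + ∑ i ∈ Finset.range n, ∑ l, C i l with hD
  have hDC : ∀ i < n, ∀ l, C i l ≤ D := fun i hi l => by
    have h1 := Finset.single_le_sum (f := fun l => C i l) (fun l _ => hC0 i l) (Finset.mem_univ l)
    have h2 := Finset.single_le_sum (f := fun i => ∑ l, C i l)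
      (fun i _ => Finset.sum_nonneg fun l _ => hC0 i l) (Finset.mem_range.2 hi)
    linarith
  have hD1 : 1 ≤ D := le_add_of_nonneg_right
    (Finset.sum_nonneg fun i _ => Finset.sum_nonneg fun l _ => hC0 i l)
  obtain ⟨ε, hε0, hε⟩ := M.exists_pow_lower_bound hA hΔ (D * R) n
  refine ⟨ε, hε0, fun x hx => ?_⟩
  have hx0 := M.lyapunov_nonneg x
  have h := hε x (by nlinarith) (T x) fun i hi l =>
    (hC i l x).trans (mul_le_mul (hDC i hi l) hx hx0 (by linarith))
  rw [hT] at h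
  simpa using h

end HawkesModel

end

/-! ### The law of the scheme as a power of the transition kernel. -/

noncomputable section

namespace HawkesModel

variable (M : HawkesModel)

theorem process_congr (Δ : ℝ) (x₀ : M.State) {Ω Ω' : Type*} {ξ : ℕ → Ω → Fin 2 → ℝ}
    {ξ' : ℕ → Ω' → Fin 2 → ℝ} {ω : Ω} {ω' : Ω'} {i : ℕ} (h : ∀ j < i, ξ j ω = ξ' j ω') :
    M.process Δ x₀ ξ i ω = M.process Δ x₀ ξ' i ω' := by
  induction i with
  | zero => rfl
  | succ i ih =>
    rw [process, process, ih fun j hj => h j (by omega), h i (by omega)]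

theorem measurable_process (hA : M.AssumptionA) (Δ : ℝ) (x₀ : M.State) {Ω : Type*}
    [MeasurableSpace Ω] {ξ : ℕ → Ω → Fin 2 → ℝ} (hξ : ∀ i, Measurable (ξ i)) (i : ℕ) :
    Measurable (M.process Δ x₀ ξ i) := by
  induction i with
  | zero => exact measurable_const
  | succ i ih => exact (M.measurable_step hA Δ).comp (ih.prodMk (hξ i))

theorem indepFun_process (hA : M.AssumptionA) (Δ : ℝ) (x₀ : M.State) {Ω : Type*}
    [MeasurableSpace Ω] {P : Measure Ω} {ξ : ℕ → Ω → Fin 2 → ℝ} (hξ : ∀ i, Measurable (ξ i))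
    (hind : iIndepFun ξ P) (i : ℕ) : IndepFun (M.process Δ x₀ ξ i) (ξ i) P := by
  have h := hind.indepFun_finset (Finset.range i) {i} (by simp) hξ
  -- Canonical noise on the space of the first i vectors, exhibiting the state at time i as a
  -- measurable function of them. The default 0 is never read before time i.
  let ζ : ℕ → (Finset.range i → Fin 2 → ℝ) → Fin 2 → ℝ := fun j u =>
    if hj : j ∈ Finset.range i then u ⟨j, hj⟩ else 0
  have hζ : ∀ j, Measurable (ζ j) := fun j => by
    by_cases hj : j ∈ Finset.range i
    · simp only [ζ, hj, dif_pos]; exact measurable_pi_apply _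
    · simp only [ζ, hj, dif_neg, not_false_iff]; exact measurable_const
  have h2 := h.comp (M.measurable_process hA Δ x₀ hζ i)
    (measurable_pi_apply (⟨i, Finset.mem_singleton_self i⟩ : ({i} : Finset ℕ)))
  have e : M.process Δ x₀ ζ i ∘ (fun ω (j : Finset.range i) => ξ j ω) = M.process Δ x₀ ξ i := by
    ext1 ω
    refine M.process_congr Δ x₀ fun j hj => ?_
    simp only [ζ, Finset.mem_range, hj, dif_pos]
  rw [e] at h2
  exact h2

theorem map_step_prod (hA : M.AssumptionA) (Δ : ℝ) (μ : Measure M.State) [SFinite μ] :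
    (μ.prod stdNormal).map (fun q => M.step Δ q.1 q.2) = μ.bind (M.transition Δ) := by
  have hm := M.measurable_step hA Δ
  ext s hs
  rw [Measure.map_apply hm hs, Measure.prod_apply (hm hs),
    Measure.bind_apply hs (Kernel.aemeasurable _)]
  refine lintegral_congr fun x => ?_
  have hx : Measurable (M.step Δ x) := hm.comp measurable_prodMk_left
  rw [transition_apply M hA, Measure.map_apply hx hs]
  rfl

theorem map_process (hA : M.AssumptionA) (Δ : ℝ) (x₀ : M.State) {Ω : Type*}
    [MeasurableSpace Ω] {P : Measure Ω} [IsProbabilityMeasure P] {ξ : ℕ → Ω → Fin 2 → ℝ}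
    (hξ : ∀ i, Measurable (ξ i)) (hlaw : ∀ i, P.map (ξ i) = stdNormal) (hind : iIndepFun ξ P)
    (i : ℕ) : P.map (M.process Δ x₀ ξ i) = (M.transition Δ ^ i) x₀ := by
  have := M.isMarkovKernel_transition hA Δ
  induction i with
  | zero =>
    rw [Kernel.pow_zero_apply]
    change P.map (fun _ => x₀) = _
    rw [Measure.map_const, measure_univ, one_smul]
  | succ i ih =>
    have hp := M.measurable_process hA Δ x₀ hξ i
    have h := (indepFun_iff_map_prod_eq_prod_map_map hp.aemeasurable (hξ i).aemeasurable).1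
      (M.indepFun_process hA Δ x₀ hξ hind i)
    rw [ih, hlaw] at h
    rw [Kernel.pow_succ_apply', ← M.map_step_prod hA, ← h,
      Measure.map_map (M.measurable_step hA Δ) (hp.prodMk (hξ i))]
    rfl

/-- The law of the scheme at time `t_i` is given by the `i`-th power of the transition kernel. -/
theorem hasLaw_process (hA : M.AssumptionA) (Δ : ℝ) (x₀ : M.State) {Ω : Type*}
    [MeasurableSpace Ω] {P : Measure Ω} [IsProbabilityMeasure P] {ξ : ℕ → Ω → Fin 2 → ℝ}
    (hξ : ∀ i, HasLaw (ξ i) stdNormal P) (hind : iIndepFun ξ P) (i : ℕ) :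
    HasLaw (M.process Δ x₀ ξ i) ((M.transition Δ ^ i) x₀) P := by
  -- `HasLaw` provides only a.e. measurability, so the noise is replaced by measurable versions that
  -- agree with it simultaneously off one null set.
  let ξ' : ℕ → Ω → Fin 2 → ℝ := fun i => (hξ i).aemeasurable.mk (ξ i)
  have hξ' : ∀ i, Measurable (ξ' i) := fun i => (hξ i).aemeasurable.measurable_mk
  have hae : ∀ i, ξ i =ᵐ[P] ξ' i := fun i => (hξ i).aemeasurable.ae_eq_mk
  have hp : M.process Δ x₀ ξ i =ᵐ[P] M.process Δ x₀ ξ' i := by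
    filter_upwards [ae_all_iff.2 hae] with ω hω
    exact M.process_congr Δ x₀ fun j _ => hω j
  refine ⟨⟨_, M.measurable_process hA Δ x₀ hξ' i, hp⟩, ?_⟩
  rw [Measure.map_congr hp]
  refine M.map_process hA Δ x₀ hξ' (fun j => ?_) (hind.congr hae) i
  rw [← Measure.map_congr (hae j), (hξ j).map_eq]

end HawkesModel

end

/-! ### Geometric ergodicity of the scheme. -/

theorem mainTheorem3 (M : HawkesModel) (hA : M.AssumptionA) (Δ : ℝ) (hΔ : 0 < Δ) :
    ∃ π : Measure M.State,
      (IsProbabilityMeasure π ∧ Kernel.Invariant (M.transition Δ) π) ∧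
      (∀ μ : Measure M.State,
        IsProbabilityMeasure μ → Kernel.Invariant (M.transition Δ) μ → μ = π) ∧
      ∀ m : ℝ, 1 ≤ m → ∃ C : ℝ, 0 < C ∧ ∃ lam : ℝ, 0 < lam ∧
        ∀ (x₀ : M.State) (g : M.State → ℝ), Measurable g →
          (∀ x, |g x| ≤ (1 + M.lyapunov x) ^ m) →
          Integrable g π ∧
          ∀ (Ω : Type*) [MeasurableSpace Ω] (P : Measure Ω) [IsProbabilityMeasure P]
            (ξ : ℕ → Ω → Fin 2 → ℝ),
            (∀ i, HasLaw (ξ i) HawkesModel.stdNormal P) → iIndepFun ξ P →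
            ∀ i : ℕ,
              Integrable (fun ω => g (M.process Δ x₀ ξ i ω)) P ∧
              |∫ ω, g (M.process Δ x₀ ξ i ω) ∂P - ∫ x, g x ∂π| ≤
                C * (1 + M.lyapunov x₀) ^ m * Real.exp (-lam * (i * Δ)) := by
  have hMk := M.isMarkovKernel_transition hA Δ
  obtain ⟨n, hn, ν, hν, hmin⟩ := M.exists_minorization hA hΔ
  have hgeo : ∀ m : ℝ, 1 ≤ m → ∃ γ K C ρ : ℝ,
      Kernel.DriftCondition (M.transition Δ) (fun x => (1 + M.lyapunov x) ^ m) γ K ∧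
      0 < C ∧ 0 < ρ ∧ ρ < 1 ∧
      ∀ φ : M.State → ℝ, Measurable φ → (∀ x, |φ x| ≤ (1 + M.lyapunov x) ^ m) → ∀ j x y,
        |∫ z, φ z ∂(M.transition Δ ^ j) x - ∫ z, φ z ∂(M.transition Δ ^ j) y| ≤
          C * ρ ^ j * ((1 + M.lyapunov x) ^ m + (1 + M.lyapunov y) ^ m) := fun m hm => by
    obtain ⟨γ, K, hd⟩ := M.exists_driftCondition hA hΔ hm
    obtain ⟨C, ρ, hC, hρ0, hρ1, h⟩ := hd.exists_geometric hn (ν := ν) fun R => by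
      obtain ⟨α, hα0, hα⟩ := hmin R
      -- Sublevel sets of (1 + G)^m lie in those of G because 1 + G ≤ (1 + G)^m, so one minorization
      -- serves all exponents.
      refine ⟨α, hα0, fun x hx => hα x (le_trans ?_ hx)⟩
      have h1 : 1 ≤ 1 + M.lyapunov x := le_add_of_nonneg_right (M.lyapunov_nonneg x)
      have h2 := Real.rpow_le_rpow_of_exponent_le h1 hm
      rw [Real.rpow_one] at h2
      linarith
    exact ⟨γ, K, C, ρ, hd, hC, hρ0, hρ1, h⟩
  -- The exponent 1 fixes the invariant measure before m is given; for other m the drift function is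
  -- integrable under any invariant probability measure, hence under this one.
  obtain ⟨γ₁, K₁, C₁, ρ₁, hd₁, -, hρ₁0, hρ₁1, hgeo₁⟩ := hgeo 1 le_rfl
  obtain ⟨π, hπ, hinv⟩ := hd₁.exists_invariant hρ₁0 hρ₁1 hgeo₁
  refine ⟨π, ⟨hπ, hinv⟩, fun μ hμ hμi => hd₁.invariant_unique hρ₁0 hρ₁1 hgeo₁ hμi hinv,
    fun m hm => ?_⟩
  obtain ⟨γ, K, C, ρ, hd, hC, hρ0, hρ1, hg⟩ := hgeo m hm
  set I := ∫ y, (1 + M.lyapunov y) ^ m ∂π with hI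
  have hI0 : 0 ≤ I := integral_nonneg fun y => (hd.pos y).le
  -- The rate is chosen so that exp(-λ i Δ) = ρ ^ i. The factor 1 + I absorbs the integral of V = (1
  -- + G)^m, since V + I ≤ (1 + I) V when V ≥ 1.
  refine ⟨C * (1 + I), by positivity, -Real.log ρ / Δ,
    div_pos (neg_pos.2 (Real.log_neg hρ0 hρ1)) hΔ, fun x₀ g hgm hgV =>
    ⟨(hd.integrable_invariant hinv).mono' hgm.aestronglyMeasurable (Filter.Eventually.of_forall hgV),
      fun Ω _ P _ ξ hξ hind i => ?_⟩⟩
  have hlaw := M.hasLaw_process hA Δ x₀ hξ hind i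
  have hint := hd.integrable_of_abs_le hgm hgV i x₀
  constructor
  · rw [← hlaw.map_eq] at hint
    exact hint.comp_aemeasurable hlaw.aemeasurable
  · have e : ∫ ω, g (M.process Δ x₀ ξ i ω) ∂P = ∫ z, g z ∂(M.transition Δ ^ i) x₀ := by
      rw [← hlaw.map_eq, integral_map hlaw.aemeasurable hgm.aestronglyMeasurable]
    rw [e]
    refine (hd.abs_integral_sub_invariant_le hgm hgV (hg g hgm hgV i) hinv x₀).trans ?_
    have hexp : Real.exp (-(-Real.log ρ / Δ) * (i * Δ)) = ρ ^ i := by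
      have : -(-Real.log ρ / Δ) * (i * Δ) = i * Real.log ρ := by field_simp
      rw [this, Real.exp_nat_mul, Real.exp_log hρ0]
    rw [hexp]
    have hV1 : 1 ≤ (1 + M.lyapunov x₀) ^ m := hd.one_le x₀
    have hle : (1 + M.lyapunov x₀) ^ m + I ≤ (1 + I) * (1 + M.lyapunov x₀) ^ m := by nlinarith
    calc C * ρ ^ i * ((1 + M.lyapunov x₀) ^ m + I)
        ≤ C * ρ ^ i * ((1 + I) * (1 + M.lyapunov x₀) ^ m) := by gcongr
      _ = _ := by ring
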